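/- Let $\mathcal M$ be a connected Hausdorff real Banach manifold of class $C^2$ modelled on a Banach space $E$, with a bounded atlas $\Omega$: a family of $C^2$ charts $(U_\alpha,\varphi_\alpha)$ covering $\mathcal M$ for which there is $K>0$ such that all transition maps $F_{\beta\alpha}=\varphi_\beta\circ\varphi_\alpha^{-1}$ satisfy $\|F_{\beta\alpha}'\|\le K$ and $\|F_{\beta\alpha}''\|\le K$ on $\varphi_\alpha(U_\alpha\cap U_\beta)$. Let $\mu$ be a non-negative Radon measure on $\mathcal M$ (a locally finite Borel measure with $\mu(A)=\sup\{\mu(L): L\subset A \text{ compact}\}$ for all Borel $A$). Conventions. For $\xi\in\bigwedge^k T_p\mathcal M$ put $|||\xi|||_p=\sup_\alpha\|\xi_{\varphi_\alpha}\|$, the supremum being over the charts of $\Omega$ at $p$, where $\xi_{\varphi}\in\bigwedge^kE$ is the representation of $\xi$ in the chart $\varphi$ and the norm on $\bigwedge^k E$ is $\|\eta\|=\sup\{|\langle\alpha,\eta\rangle| : \alpha \text{ an alternating } k\text{-form on } E,\ \|\alpha\|\le1\}$. The length of a piecewise $C^1$ curve is computed with the norms $|||\cdot|||_p$ on $T_p\mathcal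 M$, and $\rho$ is the resulting intrinsic metric on $\mathcal M$. A tensor field is of class $C_b^1$ if its local representations in all the charts of $\Omega$ are of class $C^1$ and, together with their derivatives, bounded by one common constant; a differential form is of class $C_0^1$ if it is of class $C_b^1$ and its support is $\rho$-bounded. A $k$-vector field of class $C_b^1$ is a linear combination of fields $X_1\wedge\dots\wedge X_k$ with vector fields $X_i$ of class $C_b^1$; continuous $k$-vector fields are defined likewise (for $k=0$ they are the continuous functions). A $k$-vector field $W$ is $\mu$-measurable if there are continuous $k$-vector fields $W_n$ with $|||W_n(p)-W(p)|||_p\to0$ for $\mu$-almost all $p$; it is of class $L_1(\mu)$ if moreover $\int|||W(p)|||_p\,d\mu(p)<\infty$. $L_1\bigwedge^k(\mu)$ is the space of linear combinations of decomposable $k$-vector fields of class $L_1(\mu)$ (for $k=0$: integrable functions), fields that agree $\mu$-almost everywhere being identified. Theorem. Suppose that there is a $C^1$ function $u:E\to\mathbb R$ with bounded non-empty support such that $u$ and $u'$ are bounded. Let $k\ge1$ and let $Z$ be a $k$-vector field of class $C_b^1$ on $\mathcal M$. Then there is at most one element $W\in L_1\bigwedge^{k-1}(\mu)$ which is a divergence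 of $Z$, that is, such that for every differential $(k-1)$-form $\omega$ of class $C_0^1$ on $\mathcal M$ both integrals below exist and $$\int_{\mathcal M}\langle\omega,W\rangle\,d\mu=-\int_{\mathcal M}\langle d\omega,Z\rangle\,d\mu .$$ Explicitly, if $W_1,W_2\in L_1\bigwedge^{k-1}(\mu)$ are divergences of $Z$, then $W_1=W_2$ $\mu$-almost everywhere. -/

import Mathlib

open Set Filter Topology MeasureTheory
open scoped Manifold ENNReal

noncomputable section

namespace BanachDivergence

/-! ### Exterior powers of a (tangent) space -/

/-- The natural pairing `⟨α, ξ⟩` of a bounded alternating `k`-linear form with a `k`-vector,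
determined by `⟨α, v₁ ∧ ⋯ ∧ vₖ⟩ = α (v₁, …, vₖ)`. -/
def pairing {T : Type*} [AddCommGroup T] [Module ℝ T] [TopologicalSpace T] {k : ℕ}
    (α : T [⋀^Fin k]→L[ℝ] ℝ) (ξ : ⋀[ℝ]^k T) : ℝ :=
  exteriorPower.alternatingMapLinearEquiv α.toAlternatingMap ξ

/-- The norm of a `k`-vector `ξ ∈ ⋀ᵏ E`: the supremum of `|⟨α, ξ⟩|` over the bounded alternating
`k`-forms `α` with `‖α‖ ≤ 1`. By the Hahn-Banach theorem it equals the infimum of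
`∑ᵢ ‖vᵢ₁‖ ⋯ ‖vᵢₖ‖` over all representations `ξ = ∑ᵢ vᵢ₁ ∧ ⋯ ∧ vᵢₖ`. -/
def wedgeENorm {E : Type*} [NormedAddCommGroup E] [NormedSpace ℝ E] {k : ℕ}
    (ξ : ⋀[ℝ]^k E) : ℝ≥0∞ :=
  ⨆ (α : E [⋀^Fin k]→L[ℝ] ℝ) (_ : ‖α‖ ≤ 1), ‖pairing α ξ‖ₑ

section Manifold

variable {E : Type*} [NormedAddCommGroup E] [NormedSpace ℝ E]
variable {M : Type*} [TopologicalSpace M] [ChartedSpace E M]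

/-! ### Bounded atlases -/

/-- `Ω` is a bounded atlas of the `C²` manifold `M`: its members are charts of the `C²` structure
which cover `M`, and the first two derivatives of all the transition maps `φ_β ∘ φ_α⁻¹` are bounded
by one constant. -/
structure IsBoundedAtlas (Ω : Set (OpenPartialHomeomorph M E)) : Prop where
  subset_maximalAtlas : Ω ⊆ IsManifold.maximalAtlas 𝓘(ℝ, E) 2 M
  covers : ∀ p : M, ∃ φ ∈ Ω, p ∈ φ.source
  bounded : ∃ K : ℝ, 0 < K ∧ ∀ φ ∈ Ω, ∀ ψ ∈ Ω, ∀ x ∈ (φ.symm.trans ψ).source,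
    ‖fderiv ℝ (ψ ∘ φ.symm) x‖ ≤ K ∧ ‖fderiv ℝ (fderiv ℝ (ψ ∘ φ.symm)) x‖ ≤ K

/-- The norm `|||ξ|||_p = sup_α ‖ξ_{φ_α}‖` of a tangent vector, the supremum being over the charts
of `Ω` at `p`. -/
def tangentENorm (Ω : Set (OpenPartialHomeomorph M E)) (p : M) (ξ : TangentSpace 𝓘(ℝ, E) p) :
    ℝ≥0∞ :=
  ⨆ (φ ∈ Ω) (_ : p ∈ φ.source), @enorm E _ (mfderiv 𝓘(ℝ, E) 𝓘(ℝ, E) φ p ξ)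

/-- `γ : [0, 1] → M` is piecewise of class `C¹`: it is continuous, and of class `C¹` on every closed
subinterval whose interior avoids some fixed finite set. -/
def IsPiecewiseC1 (γ : ℝ → M) : Prop :=
  ContinuousOn γ (Icc 0 1) ∧ ∃ s : Finset ℝ, ∀ a b : ℝ, a < b → Icc a b ⊆ Icc 0 1 →
    (∀ t ∈ s, t ∉ Ioo a b) → ContMDiffOn 𝓘(ℝ, ℝ) 𝓘(ℝ, E) 1 γ (Icc a b)

/-- The length of a piecewise `C¹` curve `γ : [0, 1] → M`. -/
def curveLength (Ω : Set (OpenPartialHomeomorph M E)) (γ : ℝ → M) : ℝ≥0∞ :=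
  ∫⁻ t in Icc (0 : ℝ) 1, tangentENorm Ω (γ t) (mfderiv 𝓘(ℝ, ℝ) 𝓘(ℝ, E) γ t (1 : ℝ))

/-- The intrinsic metric `ρ` of the bounded atlas `Ω`. -/
def intrinsicEDist (Ω : Set (OpenPartialHomeomorph M E)) (p q : M) : ℝ≥0∞ :=
  ⨅ (γ : ℝ → M) (_ : IsPiecewiseC1 (E := E) γ ∧ γ 0 = p ∧ γ 1 = q), curveLength Ω γ

/-- `S ⊆ M` is bounded in the intrinsic metric. -/
def IsRhoBounded (Ω : Set (OpenPartialHomeomorph M E)) (S : Set M) : Prop :=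
  ∃ R : ℝ, ∀ p ∈ S, ∀ q ∈ S, intrinsicEDist Ω p q ≤ ENNReal.ofReal R

/-! ### Vector fields and differential forms -/

variable (E M) in
/-- Vector fields on `M`, without any regularity. -/
abbrev VectorField : Type _ := ∀ p : M, TangentSpace 𝓘(ℝ, E) p

variable (E M) in
/-- Differential `k`-forms on `M`, without any regularity: to each point `p` a bounded alternating
`k`-linear form on `T_p M` is assigned. -/
abbrev DiffForm (k : ℕ) : Type _ := ∀ p : M, TangentSpace 𝓘(ℝ, E) p [⋀^Fin k]→L[ℝ] ℝ

variable (E M) in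
/-- `k`-vector fields on `M`, without any regularity. -/
abbrev KVectorField (k : ℕ) : Type _ := ∀ p : M, ⋀[ℝ]^k (TangentSpace 𝓘(ℝ, E) p)

/-- The local representation `X_φ : φ(U) → E` of a vector field in a chart. -/
def VectorField.localRep (X : VectorField E M) (φ : OpenPartialHomeomorph M E) : E → E :=
  fun y => mfderiv 𝓘(ℝ, E) 𝓘(ℝ, E) φ (φ.symm y) (X (φ.symm y))

/-- The local representation `ω_φ = (φ⁻¹)^* ω` of a differential form in a chart. -/
def DiffForm.localRep {k : ℕ} (ω : DiffForm E M k) (φ : OpenPartialHomeomorph M E) :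
    E → E [⋀^Fin k]→L[ℝ] ℝ :=
  fun y => (ω (φ.symm y)).compContinuousLinearMap (mfderiv 𝓘(ℝ, E) 𝓘(ℝ, E) φ.symm y)

/-- A tensor field, given through its local representations `T φ : φ(U) → F`, is of class `C_b¹`:
all the local representations in the charts of `Ω` are of class `C¹`, and they and their
derivatives are bounded by one constant. -/
def IsCb1 {F : Type*} [NormedAddCommGroup F] [NormedSpace ℝ F]
    (Ω : Set (OpenPartialHomeomorph M E)) (T : OpenPartialHomeomorph M E → E → F) : Prop :=
  (∀ φ ∈ Ω, ContDiffOn ℝ 1 (T φ) φ.target) ∧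
    ∃ C : ℝ, ∀ φ ∈ Ω, ∀ y ∈ φ.target, ‖T φ y‖ ≤ C ∧ ‖fderiv ℝ (T φ) y‖ ≤ C

/-- Differential forms of class `C_0¹(M)`: of class `C_b¹`, with a support that is bounded in the
intrinsic metric. -/
def DiffForm.IsC01 {k : ℕ} (Ω : Set (OpenPartialHomeomorph M E)) (ω : DiffForm E M k) : Prop :=
  IsCb1 Ω ω.localRep ∧ IsRhoBounded Ω (closure {p | ω p ≠ 0})

/-- The exterior derivative `dω`: at `p` it is the exterior derivative of the local representation
of `ω` in the preferred chart at `p`, pulled back to `T_p M` by this chart. -/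
def DiffForm.extD {k : ℕ} (ω : DiffForm E M k) : DiffForm E M (k + 1) := fun p =>
  (extDeriv (ω.localRep (chartAt E p)) (chartAt E p p)).compContinuousLinearMap
    (mfderiv 𝓘(ℝ, E) 𝓘(ℝ, E) (chartAt E p) p)

/-! ### Multivector fields -/

/-- The decomposable `k`-vector field `f • X₁ ∧ ⋯ ∧ Xₖ`. The scalar function `f` could be absorbed
into `X₁` if `k ≥ 1`; it is there for `k = 0`, where the decomposable `0`-vector fields are the
scalar functions. -/
def decomposable {k : ℕ} (f : M → ℝ) (X : Fin k → VectorField E M) : KVectorField E M k :=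
  fun p => f p • exteriorPower.ιMulti ℝ k (fun i => X i p)

/-- The `k`-vector fields of class `C_b¹`, for `k ≥ 1`: linear combinations of the fields
`X₁ ∧ ⋯ ∧ Xₖ` with vector fields `Xᵢ` of class `C_b¹`. -/
def Cb1KVectorFields (Ω : Set (OpenPartialHomeomorph M E)) (k : ℕ) :
    Submodule ℝ (KVectorField E M k) :=
  Submodule.span ℝ {Z | ∃ X : Fin k → VectorField E M,
    (∀ i, IsCb1 Ω (X i).localRep) ∧ Z = decomposable 1 X}

/-- The continuous `k`-vector fields: linear combinations of decomposable `k`-vector fields with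
continuous components. -/
def ContinuousKVectorFields (Ω : Set (OpenPartialHomeomorph M E)) (k : ℕ) :
    Submodule ℝ (KVectorField E M k) :=
  Submodule.span ℝ {Z | ∃ (f : M → ℝ) (X : Fin k → VectorField E M), Continuous f ∧
    (∀ i, ∀ φ ∈ Ω, ContinuousOn ((X i).localRep φ) φ.target) ∧ Z = decomposable f X}

/-- The norm `|||ξ|||_p = sup_α ‖ξ_{φ_α}‖` of a `k`-vector `ξ ∈ ⋀ᵏ(T_p M)`, the supremum being over
the charts of `Ω` at `p`. -/
def kVectorENorm (Ω : Set (OpenPartialHomeomorph M E)) {k : ℕ} (p : M)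
    (ξ : ⋀[ℝ]^k (TangentSpace 𝓘(ℝ, E) p)) : ℝ≥0∞ :=
  ⨆ (φ ∈ Ω) (_ : p ∈ φ.source), wedgeENorm (E := E)
    (exteriorPower.map k (mfderiv 𝓘(ℝ, E) 𝓘(ℝ, E) φ p).toLinearMap ξ)

variable [MeasurableSpace M]

/-- A `k`-vector field is `μ`-measurable if it is the limit `μ`-almost everywhere, in the norms
`|||·|||_p`, of a sequence of continuous `k`-vector fields. -/
def IsMeasurableField (Ω : Set (OpenPartialHomeomorph M E)) (μ : Measure M) {k : ℕ}
    (W : KVectorField E M k) : Prop :=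
  ∃ Y : ℕ → KVectorField E M k, (∀ n, Y n ∈ ContinuousKVectorFields Ω k) ∧
    ∀ᵐ p ∂μ, Tendsto (fun n => kVectorENorm Ω p (Y n p - W p)) atTop (𝓝 0)

/-- `W` is of class `L₁(μ)`: it is `μ`-measurable and `p ↦ |||W(p)|||_p` is integrable. -/
def IsL1Field (Ω : Set (OpenPartialHomeomorph M E)) (μ : Measure M) {k : ℕ}
    (W : KVectorField E M k) : Prop :=
  IsMeasurableField Ω μ W ∧ ∫⁻ p, kVectorENorm Ω p (W p) ∂μ < ∞

/-- (Representatives of) the elements of `L₁⋀ᵏ(μ)`: the linear combinations of decomposable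
`k`-vector fields of class `L₁(μ)`. -/
def L1KVectorFields (Ω : Set (OpenPartialHomeomorph M E)) (μ : Measure M) (k : ℕ) :
    Submodule ℝ (KVectorField E M k) :=
  Submodule.span ℝ {W | IsL1Field Ω μ W ∧
    ∃ (f : M → ℝ) (X : Fin k → VectorField E M), W = decomposable f X}

/-- The `k`-vector field `W` is a divergence of the `(k + 1)`-vector field `Z`: for every `k`-form
`ω` of class `C_0¹(M)` both integrals exist and `∫ ⟨ω, W⟩ dμ = - ∫ ⟨dω, Z⟩ dμ`. -/
def IsDivergence (Ω : Set (OpenPartialHomeomorph M E)) (μ : Measure M) {k : ℕ}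
    (Z : KVectorField E M (k + 1)) (W : KVectorField E M k) : Prop :=
  ∀ ω : DiffForm E M k, ω.IsC01 Ω →
    Integrable (fun p => pairing (ω p) (W p)) μ ∧
    Integrable (fun p => pairing (ω.extD p) (Z p)) μ ∧
    ∫ p, pairing (ω p) (W p) ∂μ = - ∫ p, pairing (ω.extD p) (Z p) ∂μ

end Manifold

/-- The Banach space `E` carries a function of class `C_0¹(E)` with non-empty (bounded) support:
`u` is `C¹`, the functions `u` and `u'` are bounded, and the support of `u` is bounded and
non-empty. -/
def HasC01Bump (E : Type*) [NormedAddCommGroup E] [NormedSpace ℝ E] : Prop :=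
  ∃ u : E → ℝ, ContDiff ℝ 1 u ∧ (∃ C : ℝ, ∀ x, ‖u x‖ ≤ C ∧ ‖fderiv ℝ u x‖ ≤ C) ∧
    Bornology.IsBounded (tsupport u) ∧ (tsupport u).Nonempty

end BanachDivergence

end

open BanachDivergence

noncomputable section

namespace BanachDivergence

/-! ### Multivectors as functionals on alternating forms -/

section Wedge

/-! The terms in `dω` cancel in the difference `W` of two divergences, so `W` is a measurable field
with `∫ ⟨ω, W⟩ dμ = 0` for all `ω` of class `C_0¹`. It must vanish almost everywhere
(`IsMeasurableField.ae_eq_zero`).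

Localize in a chart `φ` with the test forms `φ^*(v w α)`: `α` is a constant form, `w` a bump
function supported in a small ball, `v` any bounded `C¹` function. Extended by zero, such a form is
of class `C_0¹` (`IsBoundedAtlas.isC01_pullbackForm`). This needs the preimage of a closed ball
under `φ` to be closed in the whole manifold. Balls of `E` need not be compact, so the proof instead
uses the derivative bounds of the atlas, completeness of `E` and the Hausdorff property.

For fixed `α` the scalar function `h = ⟨φ^*(w α), W⟩` is then orthogonal to every `v ∘ φ`. Products
of bump functions approximate indicators of compact sets, so `h` has zero integral over compact
sets, and inner regularity gives `h = 0` almost everywhere.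

The exceptional null set depends on `α`. Since `W` is a limit of continuous fields, its values over
a compact set lie almost everywhere in the closure of a separable set of functionals, on which
countably many `α` suffice (`exists_countable_forms`). Hence `W` vanishes almost everywhere on
compact pieces near each point, and inner regularity globalizes this. -/

theorem pairing_compContinuousLinearMap {T T' : Type*} [AddCommGroup T] [Module ℝ T]
    [TopologicalSpace T] [AddCommGroup T'] [Module ℝ T'] [TopologicalSpace T'] {k : ℕ}
    (α : T' [⋀^Fin k]→L[ℝ] ℝ) (g : T →L[ℝ] T') (ξ : ⋀[ℝ]^k T) :
    pairing (α.compContinuousLinearMap g) ξ = pairing α (exteriorPower.map k g.toLinearMap ξ) := by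
  unfold pairing
  rw [← LinearMap.comp_apply]
  congr 1
  refine exteriorPower.linearMap_ext ?_
  ext v
  simp [Function.comp_def]

theorem pairing_smul {T : Type*} [AddCommGroup T] [Module ℝ T]
    [TopologicalSpace T] {k : ℕ} (c : ℝ) (α : T [⋀^Fin k]→L[ℝ] ℝ) (ξ : ⋀[ℝ]^k T) :
    pairing (c • α) ξ = c * pairing α ξ := by
  have : (c • α).toAlternatingMap = c • α.toAlternatingMap := rfl
  simp [pairing, this]

theorem pairing_zero {T : Type*} [AddCommGroup T] [Module ℝ T]
    [TopologicalSpace T] {k : ℕ} (ξ : ⋀[ℝ]^k T) :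
    pairing (0 : T [⋀^Fin k]→L[ℝ] ℝ) ξ = 0 := by
  have : (0 : T [⋀^Fin k]→L[ℝ] ℝ).toAlternatingMap = 0 := rfl
  simp [pairing, this]

theorem pairing_sub_right {T : Type*} [AddCommGroup T] [Module ℝ T]
    [TopologicalSpace T] {k : ℕ} (α : T [⋀^Fin k]→L[ℝ] ℝ) (ξ η : ⋀[ℝ]^k T) :
    pairing α (ξ - η) = pairing α ξ - pairing α η := by
  simp [pairing]

theorem continuous_of_finiteDimensional_of_multilinear {F : Type*} [NormedAddCommGroup F]
    [NormedSpace ℝ F] [FiniteDimensional ℝ F] {k : ℕ}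
    (a : MultilinearMap ℝ (fun _ : Fin k => F) ℝ) : Continuous a := by
  let b := Module.finBasis ℝ F
  have h : ∀ v : Fin k → F, a v = ∑ f : Fin k → Fin (Module.finrank ℝ F),
      (∏ j, b.coord (f j) (v j)) * a (fun j => b (f j)) := by
    intro v
    conv_lhs => rw [show v = fun j => ∑ i, b.coord i (v j) • b i from
      funext fun j => (b.sum_repr (v j)).symm]
    rw [a.map_sum]
    refine Finset.sum_congr rfl fun f _ => ?_
    rw [a.map_smul_univ (fun j => b.coord (f j) (v j)) (fun j => b (f j)), smul_eq_mul]
  rw [show (a : (Fin k → F) → ℝ) = _ from funext h]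
  refine continuous_finsetSum _ fun f _ => Continuous.mul (continuous_finsetProd _ fun j _ => ?_)
    continuous_const
  exact (b.coord (f j)).continuous_of_finiteDimensional.comp (continuous_apply j)

/-- A `k`-vector is contained in the exterior power of a finite-dimensional subspace. -/
theorem exists_finiteDimensional_mem_range_map {V : Type*} [AddCommGroup V] [Module ℝ V] {k : ℕ}
    (ξ : ⋀[ℝ]^k V) : ∃ F : Submodule ℝ V, FiniteDimensional ℝ F ∧
      ξ ∈ LinearMap.range (exteriorPower.map k F.subtype) := by
  have mono : ∀ F G : Submodule ℝ V, F ≤ G →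
      LinearMap.range (exteriorPower.map k F.subtype) ≤
        LinearMap.range (exteriorPower.map k G.subtype) := by
    rintro F G h _ ⟨η, rfl⟩
    refine ⟨exteriorPower.map k (Submodule.inclusion h) η, ?_⟩
    rw [← LinearMap.comp_apply, ← exteriorPower.map_comp, Submodule.subtype_comp_inclusion]
  have hξ : ξ ∈ Submodule.span ℝ (Set.range (exteriorPower.ιMulti ℝ k (M := V))) := by
    rw [exteriorPower.ιMulti_span]; trivial
  induction hξ using Submodule.span_induction with
  | mem x hx =>
    obtain ⟨v, rfl⟩ := hx
    refine ⟨Submodule.span ℝ (Set.range v), FiniteDimensional.span_of_finite ℝ (finite_range v), ?_⟩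
    refine ⟨exteriorPower.ιMulti ℝ k
      (fun i => ⟨v i, Submodule.subset_span (mem_range_self i)⟩), ?_⟩
    rw [exteriorPower.map_apply_ιMulti]
    rfl
  | zero => exact ⟨⊥, inferInstance, zero_mem _⟩
  | add x y _ _ hx hy =>
    obtain ⟨F, hF, hx⟩ := hx
    obtain ⟨G, hG, hy⟩ := hy
    exact ⟨F ⊔ G, inferInstance, add_mem (mono _ _ le_sup_left hx) (mono _ _ le_sup_right hy)⟩
  | smul c x _ hx =>
    obtain ⟨F, hF, hx⟩ := hx
    exact ⟨F, hF, Submodule.smul_mem _ c hx⟩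

variable {E : Type*} [NormedAddCommGroup E] [NormedSpace ℝ E] {k : ℕ}

variable (E k) in
/-- The map which regards a `k`-vector as a functional on the bounded alternating `k`-forms. -/
def toBidual : ⋀[ℝ]^k E →ₗ[ℝ] StrongDual ℝ (E [⋀^Fin k]→L[ℝ] ℝ) :=
  exteriorPower.alternatingMapLinearEquiv
    (ContinuousLinearMap.id ℝ (E [⋀^Fin k]→L[ℝ] ℝ)).flipAlternating.toAlternatingMap

theorem toBidual_ιMulti (v : Fin k → E) :
    toBidual E k (exteriorPower.ιMulti ℝ k v) =
      (ContinuousLinearMap.id ℝ (E [⋀^Fin k]→L[ℝ] ℝ)).flipAlternating v := by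
  simp [toBidual]

theorem toBidual_apply (ξ : ⋀[ℝ]^k E) (α : E [⋀^Fin k]→L[ℝ] ℝ) :
    toBidual E k ξ α = pairing α ξ := by
  have : (ContinuousLinearMap.apply ℝ ℝ α).toLinearMap ∘ₗ toBidual E k =
      exteriorPower.alternatingMapLinearEquiv α.toAlternatingMap := by
    refine exteriorPower.linearMap_ext ?_
    ext v
    simp [toBidual_ιMulti]
  exact LinearMap.congr_fun this ξ

/-- The supremum over the unit ball is an operator norm. This embeds multivectors in a genuine
normed space, where closures and separability make sense. -/
theorem wedgeENorm_eq_enorm_toBidual (ξ : ⋀[ℝ]^k E) : wedgeENorm ξ = ‖toBidual E k ξ‖ₑ := by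
  refine le_antisymm (iSup₂_le fun α hα => ?_) ?_
  · rw [← toBidual_apply, enorm_le_iff_norm_le]
    exact ((toBidual E k ξ).le_opNorm α).trans (mul_le_of_le_one_right (norm_nonneg _) hα)
  · refine le_of_forall_lt fun r hr => ?_
    have hr' : r ≠ ∞ := (hr.trans_le le_top).ne
    lift r to NNReal using hr'
    have hr2 : r < ‖toBidual E k ξ‖₊ := by
      rw [enorm_eq_nnnorm] at hr; exact_mod_cast hr
    obtain ⟨α, hα, h⟩ := (toBidual E k ξ).exists_lt_apply_of_lt_opNNNorm hr2
    refine lt_of_lt_of_le ?_ (le_iSup₂_of_le α (by exact_mod_cast hα.le) le_rfl)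
    rw [← toBidual_apply, enorm_eq_nnnorm]
    exact_mod_cast h

/-- A `k`-vector lives over a finite-dimensional subspace `F`. Every alternating form on `F` is
continuous and extends to `E` through a bounded projection onto `F`, and the forms on `F` separate
the points of its exterior power. -/
theorem toBidual_injective : Function.Injective (toBidual E k) := by
  rw [injective_iff_map_eq_zero]
  intro ξ hξ
  obtain ⟨F, hF, η, rfl⟩ := exists_finiteDimensional_mem_range_map ξ
  obtain ⟨P, hP⟩ := Submodule.ClosedComplemented.of_finiteDimensional F
  have hPF : P.toLinearMap ∘ₗ F.subtype = LinearMap.id := by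
    ext x; simp [hP]
  suffices η = 0 by simp [this]
  rw [← Module.forall_dual_apply_eq_zero_iff ℝ]
  intro f
  obtain ⟨a, rfl⟩ := exteriorPower.alternatingMapLinearEquiv.surjective f
  let a' : F [⋀^Fin k]→L[ℝ] ℝ :=
    { a with cont := continuous_of_finiteDimensional_of_multilinear a.toMultilinearMap }
  have h := toBidual_apply (exteriorPower.map k F.subtype η) (a'.compContinuousLinearMap P)
  rw [hξ, pairing_compContinuousLinearMap, ← LinearMap.comp_apply, ← exteriorPower.map_comp, hPF,
    exteriorPower.map_id] at h
  exact h.symm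

end Wedge

/-! ### Bump functions and approximate indicators of compact sets -/

section BoundedC1

variable {E : Type*} [NormedAddCommGroup E] [NormedSpace ℝ E]

/-- A `C¹` function which is bounded together with its derivative. -/
def IsBoundedC1 (v : E → ℝ) : Prop :=
  ContDiff ℝ 1 v ∧ ∃ C : ℝ, ∀ x, ‖v x‖ ≤ C ∧ ‖fderiv ℝ v x‖ ≤ C

theorem IsBoundedC1.differentiable {v : E → ℝ} (hv : IsBoundedC1 v) : Differentiable ℝ v :=
  hv.1.differentiable one_ne_zero

theorem isBoundedC1_const (c : ℝ) : IsBoundedC1 (fun _ : E => c) :=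
  ⟨contDiff_const, ‖c‖, fun x => ⟨le_rfl, by simp⟩⟩

theorem IsBoundedC1.sub {v w : E → ℝ} (hv : IsBoundedC1 v) (hw : IsBoundedC1 w) :
    IsBoundedC1 (fun x => v x - w x) := by
  obtain ⟨C, hC⟩ := hv.2
  obtain ⟨D, hD⟩ := hw.2
  refine ⟨hv.1.sub hw.1, C + D, fun x => ⟨?_, ?_⟩⟩
  · exact (norm_sub_le _ _).trans (add_le_add (hC x).1 (hD x).1)
  · rw [fderiv_fun_sub (hv.differentiable x) (hw.differentiable x)]
    exact (norm_sub_le _ _).trans (add_le_add (hC x).2 (hD x).2)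

theorem IsBoundedC1.mul {v w : E → ℝ} (hv : IsBoundedC1 v) (hw : IsBoundedC1 w) :
    IsBoundedC1 (fun x => v x * w x) := by
  obtain ⟨C, hC⟩ := hv.2
  obtain ⟨D, hD⟩ := hw.2
  have hC0 : 0 ≤ C := (norm_nonneg _).trans (hC 0).1
  have hD0 : 0 ≤ D := (norm_nonneg _).trans (hD 0).1
  refine ⟨hv.1.mul hw.1, C * D + D * C, fun x => ⟨?_, ?_⟩⟩
  · rw [norm_mul]
    exact (mul_le_mul (hC x).1 (hD x).1 (norm_nonneg _) hC0).trans
      (le_add_of_nonneg_right (mul_nonneg hD0 hC0))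
  · rw [fderiv_fun_mul (hv.differentiable x) (hw.differentiable x)]
    refine (norm_add_le _ _).trans (add_le_add ?_ ?_) <;> rw [norm_smul]
    · exact mul_le_mul (hC x).1 (hD x).2 (norm_nonneg _) hC0
    · exact mul_le_mul (hD x).1 (hC x).2 (norm_nonneg _) hD0

theorem IsBoundedC1.prod {ι : Type*} {s : Finset ι} {v : ι → E → ℝ}
    (hv : ∀ i ∈ s, IsBoundedC1 (v i)) : IsBoundedC1 (fun x => ∏ i ∈ s, v i x) := by
  classical
  induction s using Finset.induction_on with
  | empty => simpa using isBoundedC1_const (E := E) 1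
  | insert i s hi ih =>
    simp only [Finset.prod_insert hi]
    exact (hv i (by simp)).mul (ih fun j hj => hv j (by simp [hj]))

theorem IsBoundedC1.pow {v : E → ℝ} (hv : IsBoundedC1 v) (n : ℕ) :
    IsBoundedC1 (fun x => v x ^ n) := by
  simpa using IsBoundedC1.prod (s := Finset.range n) (v := fun _ => v) fun _ _ => hv

theorem IsBoundedC1.comp_add_smul {v : E → ℝ} (hv : IsBoundedC1 v) (a x : E) (s : ℝ) :
    IsBoundedC1 (fun y => v (a + s • (y - x))) := by
  obtain ⟨C, hC⟩ := hv.2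
  have hC0 : 0 ≤ C := (norm_nonneg _).trans (hC 0).1
  have hd : ∀ y : E, HasFDerivAt (fun y => a + s • (y - x)) (s • ContinuousLinearMap.id ℝ E) y :=
    fun y => (((hasFDerivAt_id y).sub_const x).const_smul s).const_add a
  refine ⟨hv.1.comp (by fun_prop), C + C * |s|, fun y => ⟨?_, ?_⟩⟩
  · exact (hC _).1.trans (le_add_of_nonneg_right (by positivity))
  · have := ((hv.differentiable (a + s • (y - x))).hasFDerivAt.comp y (hd y)).fderiv
    rw [show (fun y => v (a + s • (y - x))) = v ∘ (fun y => a + s • (y - x)) from rfl, this]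
    refine (ContinuousLinearMap.opNorm_comp_le _ _).trans ?_
    refine (mul_le_mul (hC _).2 ?_ (norm_nonneg _) hC0).trans (le_add_of_nonneg_left hC0)
    rw [norm_smul, Real.norm_eq_abs]
    exact mul_le_of_le_one_right (abs_nonneg _) ContinuousLinearMap.norm_id_le

/-- Bump functions with arbitrarily small support. -/
theorem HasC01Bump.exists_bump (hE : HasC01Bump E) (x : E) {δ : ℝ} (hδ : 0 < δ) :
    ∃ w : E → ℝ, IsBoundedC1 w ∧ (∀ y, 0 ≤ w y ∧ w y ≤ 1) ∧ 0 < w x ∧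
      ∀ y, w y ≠ 0 → y ∈ Metric.ball x δ := by
  obtain ⟨u, hu, ⟨C, hC⟩, hb, hne⟩ := hE
  have hu1 : IsBoundedC1 u := ⟨hu, C, hC⟩
  obtain ⟨a, ha⟩ : ∃ a, u a ≠ 0 := by
    by_contra! h
    have : u = 0 := funext h
    simp [this] at hne
  have hCpos : 0 < C := (norm_pos_iff.2 ha).trans_le (hC a).1
  obtain ⟨R, hR⟩ := hb.exists_norm_le
  have hR0 : 0 ≤ R := (norm_nonneg _).trans (hR a (subset_tsupport _ ha))
  -- With this scale `s * δ` exceeds `R + ‖a‖`, the largest possible norm of `s • (y - x)` when `u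
  -- (a + s • (y - x)) ≠ 0`. Squaring below makes the function nonnegative.
  let s : ℝ := (R + ‖a‖ + 1) / δ
  have hs : 0 < s := by positivity
  refine ⟨fun y => (C⁻¹ * u (a + s • (y - x))) ^ 2,
    ((isBoundedC1_const C⁻¹).mul (hu1.comp_add_smul a x s)).pow 2, fun y => ⟨by positivity, ?_⟩,
    ?_, fun y hy => ?_⟩
  · rw [sq_le_one_iff_abs_le_one, abs_mul, abs_of_pos (inv_pos.2 hCpos), inv_mul_le_iff₀ hCpos,
      mul_one]
    exact (hC _).1
  · simp only [sub_self, smul_zero, add_zero]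
    positivity
  · have h1 : u (a + s • (y - x)) ≠ 0 := by
      intro h; simp [h] at hy
    have h2 : ‖s • (y - x)‖ ≤ R + ‖a‖ := by
      calc ‖s • (y - x)‖ = ‖(a + s • (y - x)) - a‖ := by simp
        _ ≤ _ := (norm_sub_le _ _).trans (by gcongr; exact hR _ (subset_tsupport _ h1))
    rw [norm_smul, Real.norm_of_nonneg hs.le] at h2
    rw [Metric.mem_ball, dist_eq_norm]
    have h3 : s * ‖y - x‖ < s * δ := by
      have : s * δ = R + ‖a‖ + 1 := by simp only [s]; field_simp
      linarith
    exact lt_of_mul_lt_mul_left h3 hs.le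

/-- Approximation of the indicator function of a compact set. -/
theorem HasC01Bump.exists_approx_indicator (hE : HasC01Bump E) {K : Set E} (hK : IsCompact K)
    {δ ε : ℝ} (hδ : 0 < δ) (hε : 0 < ε) :
    ∃ v : E → ℝ, IsBoundedC1 v ∧ (∀ y, 0 ≤ v y ∧ v y ≤ 1) ∧ (∀ y ∈ K, 1 - ε ≤ v y) ∧
      ∀ y, v y ≠ 0 → y ∈ Metric.thickening δ K := by
  classical
  choose w hw hw01 hwx hws using fun x : E => hE.exists_bump x hδ
  obtain ⟨t, htK, ht⟩ := hK.elim_nhds_subcover (fun x => {y | 0 < w x y}) fun x _ =>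
    (isOpen_lt continuous_const (hw x).1.continuous).mem_nhds (hwx x)
  -- The product is `1` away from `K` and less than `1` on `K`, by compactness uniformly so. Thus `1
  -- - p ^ n` vanishes outside the thickening and is close to `1` on `K` for large `n`.
  let p : E → ℝ := fun y => ∏ x ∈ t, (1 - w x y)
  have hp : IsBoundedC1 p := IsBoundedC1.prod fun x _ => (isBoundedC1_const 1).sub (hw x)
  have hp0 : ∀ y, 0 ≤ p y := fun y => Finset.prod_nonneg fun x _ => by linarith [(hw01 x y).2]
  have hp1 : ∀ y, p y ≤ 1 := fun y => Finset.prod_le_one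
    (fun x _ => by linarith [(hw01 x y).2]) fun x _ => by linarith [(hw01 x y).1]
  have hpK : ∀ y ∈ K, p y < 1 := by
    intro y hy
    obtain ⟨x, hx, hxy⟩ := mem_iUnion₂.1 (ht hy)
    rw [mem_ofPred_eq] at hxy
    calc p y = (1 - w x y) * ∏ z ∈ t.erase x, (1 - w z y) :=
          (Finset.mul_prod_erase t (fun z => 1 - w z y) hx).symm
      _ ≤ (1 - w x y) * 1 := by
          refine mul_le_mul_of_nonneg_left (Finset.prod_le_one
            (fun z _ => by linarith [(hw01 z y).2]) fun z _ => by linarith [(hw01 z y).1]) ?_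
          linarith [(hw01 x y).2]
      _ < 1 := by linarith
  obtain ⟨c, hc0, hc1, hc⟩ : ∃ c : ℝ, 0 ≤ c ∧ c < 1 ∧ ∀ y ∈ K, p y ≤ c := by
    rcases K.eq_empty_or_nonempty with rfl | hne
    · exact ⟨0, le_rfl, one_pos, by simp⟩
    · obtain ⟨y, hy, hmax⟩ := hK.exists_isMaxOn hne hp.1.continuous.continuousOn
      exact ⟨p y, hp0 y, hpK y hy, hmax⟩
  obtain ⟨n, hn⟩ := exists_pow_lt_of_lt_one hε hc1
  refine ⟨fun y => 1 - p y ^ n, (isBoundedC1_const 1).sub (hp.pow n), fun y => ⟨?_, ?_⟩,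
    fun y hy => ?_, fun y hy => ?_⟩
  · linarith [pow_le_one₀ (n := n) (hp0 y) (hp1 y)]
  · linarith [pow_nonneg (hp0 y) n]
  · linarith [pow_le_pow_left₀ (hp0 y) (hc y hy) n]
  · by_contra hcon
    refine hy ?_
    have : p y = 1 := Finset.prod_eq_one fun x hx => by
      by_cases h : w x y = 0
      · simp [h]
      · exact absurd (Metric.mem_thickening_iff.2 ⟨x, htK x hx, hws x y h⟩) hcon
    simp [this]

end BoundedC1

/-! ### Integrable functions orthogonal to bounded `C¹` functions -/

section Separation

/-- An integrable function with vanishing integrals over all compact sets is nonpositive almost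
everywhere. -/
theorem ae_nonpos_of_forall_setIntegral_isCompact_eq_zero {X : Type*} [TopologicalSpace X]
    [T2Space X] [MeasurableSpace X] [BorelSpace X] {μ : Measure X} [μ.InnerRegular] {h : X → ℝ}
    (hi : Integrable h μ) {U : Set X} (hU : IsOpen U) (h0 : ∀ p ∉ U, h p = 0)
    (hL : ∀ L ⊆ U, IsCompact L → ∫ p in L, h p ∂μ = 0) : ∀ᵐ p ∂μ, h p ≤ 0 := by
  -- The set where `h` is positive need not be Borel; a strongly measurable version `g` provides a
  -- Borel set to which inner regularity applies.
  obtain ⟨g, hgm, hg⟩ := hi.1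
  let A : Set X := {p | 0 < g p} ∩ U
  have hA : MeasurableSet A := (measurableSet_lt measurable_const hgm.measurable).inter
    hU.measurableSet
  have hμA : μ A = 0 := by
    by_contra hne
    obtain ⟨K, hKA, hK, hpos⟩ := hA.exists_lt_isCompact (pos_iff_ne_zero.2 hne)
    have h1 : ∫ p in K, g p ∂μ = 0 := by
      rw [← hL K (fun p hp => (hKA hp).2) hK]
      exact integral_congr_ae (ae_restrict_of_ae hg.symm)
    have hnn : 0 ≤ᵐ[μ.restrict K] g :=
      (ae_restrict_iff' hK.measurableSet).2 (Eventually.of_forall fun p hp => (hKA hp).1.le)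
    have h2 := (setIntegral_pos_iff_support_of_nonneg_ae hnn
      ((hi.congr hg).integrableOn)).2 (by
        have : Function.support g ∩ K = K :=
          inter_eq_self_of_subset_right fun p hp => (hKA hp).1.ne'
        rwa [this])
    exact h2.ne' h1
  filter_upwards [hg, measure_eq_zero_iff_ae_notMem.1 hμA] with p hp hpA
  by_contra! hcon
  refine hpA ⟨by rwa [mem_ofPred_eq, ← hp], ?_⟩
  by_contra hpU
  exact hcon.ne' (h0 p hpU)

/-- An integrable function which is supported in a chart domain and orthogonal to all bounded `C¹`
functions vanishes almost everywhere. -/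
theorem ae_eq_zero_of_forall_integral_boundedC1_mul_eq_zero {E : Type*} [NormedAddCommGroup E]
    [NormedSpace ℝ E] (hE : HasC01Bump E) {X : Type*} [TopologicalSpace X]
    [T2Space X] [MeasurableSpace X] [BorelSpace X] {μ : Measure X} [μ.InnerRegular]
    (φ : OpenPartialHomeomorph X E) {h : X → ℝ} (h0 : ∀ p ∉ φ.source, h p = 0)
    (hv : ∀ v : E → ℝ, IsBoundedC1 v → Integrable (fun p => v (φ p) * h p) μ ∧
      ∫ p, v (φ p) * h p ∂μ = 0) : ∀ᵐ p ∂μ, h p = 0 := by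
  have hi : Integrable h μ := by simpa using (hv _ (isBoundedC1_const 1)).1
  have key : ∀ L ⊆ φ.source, IsCompact L → ∫ p in L, h p ∂μ = 0 := by
    intro L hLs hL
    have hKc : IsCompact (φ '' L) := hL.image_of_continuousOn (φ.continuousOn.mono hLs)
    choose v hvC hv01 hvK hvs using fun n : ℕ => hE.exists_approx_indicator hKc
      (δ := 1 / ((n : ℝ) + 1)) (ε := 1 / ((n : ℝ) + 1)) (by positivity) (by positivity)
    have hlim : Tendsto (fun n : ℕ => 1 / ((n : ℝ) + 1)) atTop (𝓝 0) :=
      tendsto_one_div_add_atTop_nhds_zero_nat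
    have := tendsto_integral_of_dominated_convergence (μ := μ)
      (F := fun n p => v n (φ p) * h p) (f := L.indicator h) (fun p => ‖h p‖)
      (fun n => (hv _ (hvC n)).1.1) hi.norm
      (fun n => Eventually.of_forall fun p => by
        rw [norm_mul, Real.norm_of_nonneg (hv01 n _).1]
        exact mul_le_of_le_one_left (norm_nonneg _) (hv01 n _).2)
      (Eventually.of_forall fun p => by
        by_cases hp : p ∈ φ.source
        swap
        · rw [indicator_of_notMem fun h => hp (hLs h), h0 p hp]
          simp
        by_cases hpL : p ∈ L
        · rw [indicator_of_mem hpL]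
          have h1 : Tendsto (fun n => v n (φ p)) atTop (𝓝 1) :=
            tendsto_of_tendsto_of_tendsto_of_le_of_le (by simpa using hlim.const_sub 1)
              tendsto_const_nhds (fun n => hvK n _ (mem_image_of_mem _ hpL))
              fun n => (hv01 n _).2
          simpa using h1.mul_const (h p)
        · rw [indicator_of_notMem hpL]
          -- The point `φ p` has positive distance from the compact set `φ '' L`, so it leaves the
          -- shrinking thickenings and `v n (φ p)` is eventually zero.
          have hpK : φ p ∉ φ '' L := by
            rintro ⟨q, hq, hqp⟩
            exact hpL (φ.injOn (hLs hq) hp hqp ▸ hq)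
          obtain ⟨δ, hδ, hd⟩ := Metric.nhds_basis_ball.mem_iff.1
            (hKc.isClosed.isOpen_compl.mem_nhds hpK)
          refine tendsto_const_nhds.congr' ?_
          filter_upwards [(tendsto_order.1 hlim).2 δ hδ] with n hn
          have : v n (φ p) = 0 := by
            by_contra hne
            obtain ⟨z, hz, hzd⟩ := Metric.mem_thickening_iff.1 (hvs n _ hne)
            exact hd (Metric.mem_ball'.2 (hzd.trans hn)) hz
          simp [this])
    rw [integral_indicator hL.measurableSet] at this
    refine tendsto_nhds_unique this ?_
    simp only [(hv _ (hvC _)).2]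
    exact tendsto_const_nhds
  filter_upwards [ae_nonpos_of_forall_setIntegral_isCompact_eq_zero hi φ.open_source h0 key,
    ae_nonpos_of_forall_setIntegral_isCompact_eq_zero (h := fun p => -h p) hi.neg φ.open_source
      (fun p hp => by simp [h0 p hp]) (fun L hLs hL => by
        rw [integral_neg, key L hLs hL, neg_zero])] with p h1 h2
  linarith

end Separation

/-! ### Differentiating the pullback of a constant form -/

section Pullback

variable {E : Type*} [NormedAddCommGroup E] [NormedSpace ℝ E] {k : ℕ}

/-- The derivative is a sum of `k` terms, each with `B` in one slot and `A` in the others. Since `1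
≤ K`, the natural bound with `K ^ (k - 1)` may be weakened to `K ^ k`. -/
theorem norm_fderivCompContinuousLinearMap_le (α : E [⋀^Fin k]→L[ℝ] ℝ) (A : E →L[ℝ] E) {K : ℝ}
    (hK : 1 ≤ K) (hA : ‖A‖ ≤ K) :
    ‖α.fderivCompContinuousLinearMap A‖ ≤ k * (‖α‖ * K ^ k) := by
  have hK0 : 0 ≤ K := zero_le_one.trans hK
  refine ContinuousLinearMap.opNorm_le_bound _ (by positivity) fun B => ?_
  refine ContinuousAlternatingMap.opNorm_le_bound _ (by positivity) fun v => ?_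
  rw [ContinuousAlternatingMap.fderivCompContinuousLinearMap_apply]
  refine (norm_sum_le _ _).trans ?_
  have : ∀ i ∈ (Finset.univ : Finset (Fin k)),
      ‖α fun j => Function.update (fun _ => A) i B j (v j)‖ ≤
        ‖α‖ * K ^ k * ‖B‖ * ∏ j, ‖v j‖ := by
    intro i _
    refine (α.le_opNorm _).trans ?_
    have h2 : ∏ j, ‖Function.update (fun _ => A) i B j (v j)‖ ≤
        ∏ j, (K * (if j = i then ‖B‖ else 1)) * ‖v j‖ := by
      refine Finset.prod_le_prod (fun _ _ => norm_nonneg _) fun j _ => ?_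
      refine (ContinuousLinearMap.le_opNorm _ _).trans ?_
      refine mul_le_mul_of_nonneg_right ?_ (norm_nonneg _)
      by_cases hj : j = i
      · subst hj
        simpa using le_mul_of_one_le_left (norm_nonneg B) hK
      · simpa [hj] using hA
    refine (mul_le_mul_of_nonneg_left h2 (norm_nonneg _)).trans_eq ?_
    rw [Finset.prod_mul_distrib, Finset.prod_mul_distrib, Finset.prod_ite_eq' Finset.univ i]
    simp
    ring
  refine (Finset.sum_le_card_nsmul _ _ _ this).trans_eq ?_
  simp
  ring

theorem hasFDerivAt_compContinuousLinearMap_right (α : E [⋀^Fin k]→L[ℝ] ℝ) (A : E →L[ℝ] E) :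
    HasFDerivAt (fun A : E →L[ℝ] E => α.compContinuousLinearMap A)
      (α.fderivCompContinuousLinearMap A) A := by
  simpa using (hasFDerivAt_const α A).continuousAlternatingMapCompContinuousLinearMap
    (hasFDerivAt_id A)

/-- Only continuity of the known derivative is at stake. As a map into multilinear forms, the
pullback is a continuous multilinear map restricted to the diagonal, hence `C¹`. Composition with
the isometric inclusion `J` of alternating into multilinear forms is an isometry, so continuity can
be tested after it. -/
theorem contDiff_compContinuousLinearMap_right (α : E [⋀^Fin k]→L[ℝ] ℝ) :
    ContDiff ℝ 1 (fun A : E →L[ℝ] E => α.compContinuousLinearMap A) := by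
  rw [contDiff_one_iff_hasFDerivAt]
  refine ⟨fun A => α.fderivCompContinuousLinearMap A, ?_,
    hasFDerivAt_compContinuousLinearMap_right α⟩
  let J := ContinuousAlternatingMap.toContinuousMultilinearMapLI (𝕜 := ℝ) (E := E) (F := ℝ)
    (ι := Fin k)
  let m : (E →L[ℝ] E) → ContinuousMultilinearMap ℝ (fun _ : Fin k => E) ℝ := fun A =>
    ContinuousMultilinearMap.compContinuousLinearMapContinuousMultilinear ℝ
      (fun _ : Fin k => E) (fun _ => E) ℝ (fun _ => A) α.1
  have hm : ContDiff ℝ 1 m := by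
    have h1 : ContDiff ℝ 1 (fun A : Fin k → E →L[ℝ] E =>
        ContinuousMultilinearMap.compContinuousLinearMapContinuousMultilinear ℝ
          (fun _ : Fin k => E) (fun _ => E) ℝ A) := ContinuousMultilinearMap.contDiff _
    have h2 : ContDiff ℝ 1 (fun A : E →L[ℝ] E => (fun _ : Fin k => A)) :=
      contDiff_pi.2 fun _ => contDiff_id
    exact (h1.comp h2).clm_apply contDiff_const
  have hJ : ∀ A, HasFDerivAt m
      (J.toContinuousLinearMap.comp (α.fderivCompContinuousLinearMap A)) A := fun A =>
    J.toContinuousLinearMap.hasFDerivAt.comp A (hasFDerivAt_compContinuousLinearMap_right α A)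
  have hc : Continuous fun A =>
      J.toContinuousLinearMap.comp (α.fderivCompContinuousLinearMap A) := by
    have := hm.continuous_fderiv one_ne_zero
    rwa [show fderiv ℝ m = _ from funext fun A => (hJ A).fderiv] at this
  have hiso : Isometry fun B : (E →L[ℝ] E) →L[ℝ] (E [⋀^Fin k]→L[ℝ] ℝ) =>
      J.toContinuousLinearMap.comp B := by
    refine Isometry.of_dist_eq fun B C => ?_
    rw [dist_eq_norm, dist_eq_norm, ← ContinuousLinearMap.comp_sub,
      LinearIsometry.norm_toContinuousLinearMap_comp]
  exact hiso.isEmbedding.continuous_iff.2 hc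

/-- Regularity and bounds of the local expression `F^*(v α)` of a differential form. -/
theorem contDiffAt_and_norm_le_of_pullback {v : E → ℝ} (hv : ContDiff ℝ 1 v) {C : ℝ}
    (hC : ∀ x, ‖v x‖ ≤ C ∧ ‖fderiv ℝ v x‖ ≤ C) (α : E [⋀^Fin k]→L[ℝ] ℝ) {F : E → E} {y : E}
    (hF : ContDiffAt ℝ 2 F y) {K : ℝ} (hK : 1 ≤ K) (h1 : ‖fderiv ℝ F y‖ ≤ K)
    (h2 : ‖fderiv ℝ (fderiv ℝ F) y‖ ≤ K) :
    ContDiffAt ℝ 1 (fun y => v (F y) • α.compContinuousLinearMap (fderiv ℝ F y)) y ∧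
    ‖v (F y) • α.compContinuousLinearMap (fderiv ℝ F y)‖ ≤ C * (‖α‖ * K ^ k) ∧
    ‖fderiv ℝ (fun y => v (F y) • α.compContinuousLinearMap (fderiv ℝ F y)) y‖ ≤
      C * (k * (‖α‖ * K ^ k) * K) + C * K * (‖α‖ * K ^ k) := by
  have hC0 : 0 ≤ C := (norm_nonneg _).trans (hC 0).1
  have hK0 : 0 ≤ K := zero_le_one.trans hK
  have hF' : ContDiffAt ℝ 1 (fderiv ℝ F) y := hF.fderiv_right (by norm_num)
  have hF1 : ContDiffAt ℝ 1 F y := hF.of_le (by norm_num)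
  have hQ : ‖α.compContinuousLinearMap (fderiv ℝ F y)‖ ≤ ‖α‖ * K ^ k := by
    refine (α.norm_compContinuousLinearMap_le (fderiv ℝ F y)).trans ?_
    rw [Fintype.card_fin]
    exact mul_le_mul_of_nonneg_left (pow_le_pow_left₀ (norm_nonneg _) h1 k) (norm_nonneg _)
  have hvF : HasFDerivAt (fun y => v (F y)) ((fderiv ℝ v (F y)).comp (fderiv ℝ F y)) y :=
    (hv.differentiable one_ne_zero (F y)).hasFDerivAt.comp y
      (hF1.differentiableAt one_ne_zero).hasFDerivAt
  have hQF : HasFDerivAt (fun y => α.compContinuousLinearMap (fderiv ℝ F y))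
      ((α.fderivCompContinuousLinearMap (fderiv ℝ F y)).comp (fderiv ℝ (fderiv ℝ F) y)) y :=
    (hasFDerivAt_compContinuousLinearMap_right α _).comp y
      (hF'.differentiableAt one_ne_zero).hasFDerivAt
  refine ⟨?_, ?_, ?_⟩
  · exact (hv.contDiffAt.comp y hF1).smul
      ((contDiff_compContinuousLinearMap_right α).contDiffAt.comp y hF')
  · rw [norm_smul]
    exact mul_le_mul (hC _).1 hQ (norm_nonneg _) hC0
  · rw [(hvF.fun_smul hQF).fderiv]
    have hn := norm_add_le (v (F y) • (α.fderivCompContinuousLinearMap (fderiv ℝ F y)).comp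
      (fderiv ℝ (fderiv ℝ F) y)) (((fderiv ℝ v (F y)).comp (fderiv ℝ F y)).smulRight
        (α.compContinuousLinearMap (fderiv ℝ F y)))
    refine hn.trans (add_le_add ?_ ?_)
    · rw [norm_smul]
      refine mul_le_mul (hC _).1 ?_ (norm_nonneg _) hC0
      refine (ContinuousLinearMap.opNorm_comp_le _ _).trans ?_
      exact mul_le_mul (norm_fderivCompContinuousLinearMap_le α _ hK h1) h2 (norm_nonneg _)
        (by positivity)
    · rw [ContinuousLinearMap.norm_smulRight_apply]
      refine mul_le_mul ?_ hQ (norm_nonneg _) (by positivity)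
      refine (ContinuousLinearMap.opNorm_comp_le _ _).trans ?_
      exact mul_le_mul (hC _).2 h1 (norm_nonneg _) hC0

end Pullback

/-! ### Chain rule for charts and transition maps -/

section Charts

variable {E : Type*} [NormedAddCommGroup E] [NormedSpace ℝ E]
variable {M : Type*} [TopologicalSpace M] [ChartedSpace E M]
variable {φ ψ : OpenPartialHomeomorph M E}

theorem mdifferentiableAt_of_mem_maximalAtlas (hφ : φ ∈ IsManifold.maximalAtlas 𝓘(ℝ, E) 2 M)
    {p : M} (hp : p ∈ φ.source) : MDifferentiableAt 𝓘(ℝ, E) 𝓘(ℝ, E) φ p :=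
  ((contMDiffOn_of_mem_maximalAtlas hφ).contMDiffAt (φ.open_source.mem_nhds hp)).mdifferentiableAt
    two_ne_zero

theorem mdifferentiableAt_symm_of_mem_maximalAtlas
    (hφ : φ ∈ IsManifold.maximalAtlas 𝓘(ℝ, E) 2 M)
    {y : E} (hy : y ∈ φ.target) : MDifferentiableAt 𝓘(ℝ, E) 𝓘(ℝ, E) φ.symm y :=
  ((contMDiffOn_symm_of_mem_maximalAtlas hφ).contMDiffAt
    (φ.open_target.mem_nhds hy)).mdifferentiableAt two_ne_zero

theorem contDiffAt_transition (hφ : φ ∈ IsManifold.maximalAtlas 𝓘(ℝ, E) 2 M)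
    (hψ : ψ ∈ IsManifold.maximalAtlas 𝓘(ℝ, E) 2 M) {y : E} (hy : y ∈ (φ.symm.trans ψ).source) :
    ContDiffAt ℝ 2 (ψ ∘ φ.symm) y := by
  rw [OpenPartialHomeomorph.trans_source, OpenPartialHomeomorph.symm_source] at hy
  rw [← contMDiffAt_iff_contDiffAt]
  exact ((contMDiffOn_of_mem_maximalAtlas hψ).contMDiffAt (ψ.open_source.mem_nhds hy.2)).comp y
    ((contMDiffOn_symm_of_mem_maximalAtlas hφ).contMDiffAt (φ.open_target.mem_nhds hy.1))

theorem mfderiv_comp_mfderiv_symm (hφ : φ ∈ IsManifold.maximalAtlas 𝓘(ℝ, E) 2 M)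
    (hψ : ψ ∈ IsManifold.maximalAtlas 𝓘(ℝ, E) 2 M) {y : E} (hy : y ∈ (φ.symm.trans ψ).source) :
    (mfderiv 𝓘(ℝ, E) 𝓘(ℝ, E) ψ (φ.symm y)).comp (mfderiv 𝓘(ℝ, E) 𝓘(ℝ, E) φ.symm y) =
      fderiv ℝ (ψ ∘ φ.symm) y := by
  rw [OpenPartialHomeomorph.trans_source, OpenPartialHomeomorph.symm_source] at hy
  rw [← mfderiv_eq_fderiv]
  exact (mfderiv_comp y (mdifferentiableAt_of_mem_maximalAtlas hψ hy.2)
    (mdifferentiableAt_symm_of_mem_maximalAtlas hφ hy.1)).symm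

theorem mfderiv_symm_comp_mfderiv (hφ : φ ∈ IsManifold.maximalAtlas 𝓘(ℝ, E) 2 M)
    {p : M} (hp : p ∈ φ.source) :
    (mfderiv 𝓘(ℝ, E) 𝓘(ℝ, E) φ.symm (φ p)).comp (mfderiv 𝓘(ℝ, E) 𝓘(ℝ, E) φ p) =
      ContinuousLinearMap.id ℝ (TangentSpace 𝓘(ℝ, E) p) := by
  have h := mfderiv_comp p (mdifferentiableAt_symm_of_mem_maximalAtlas hφ (φ.map_source hp))
    (mdifferentiableAt_of_mem_maximalAtlas hφ hp)
  rw [← mfderiv_id, ← h]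
  refine Filter.EventuallyEq.mfderiv_eq ?_
  filter_upwards [φ.open_source.mem_nhds hp] with q hq
  exact φ.left_inv hq

end Charts

/-! ### Closed sets and distances in a bounded atlas -/

section Topology

variable {E : Type*} [NormedAddCommGroup E] [NormedSpace ℝ E]
variable {M : Type*} [TopologicalSpace M] [ChartedSpace E M]
variable {Ω : Set (OpenPartialHomeomorph M E)}

theorem IsBoundedAtlas.mem_maximalAtlas (hΩ : IsBoundedAtlas Ω) {φ : OpenPartialHomeomorph M E}
    (hφ : φ ∈ Ω) : φ ∈ IsManifold.maximalAtlas 𝓘(ℝ, E) 2 M :=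
  hΩ.subset_maximalAtlas hφ

/-- In a Hausdorff manifold with a bounded atlas, a path which is a straight line segment in one
chart can leave the domain of another chart only through the boundary. -/
theorem IsBoundedAtlas.mem_source_of_segment [CompleteSpace E] [T2Space M]
    (hΩ : IsBoundedAtlas Ω) {K : ℝ}
    (hK : ∀ φ ∈ Ω, ∀ ψ ∈ Ω, ∀ x ∈ (φ.symm.trans ψ).source, ‖fderiv ℝ (ψ ∘ φ.symm) x‖ ≤ K)
    {φ ψ : OpenPartialHomeomorph M E}
    (hφ : φ ∈ Ω) (hψ : ψ ∈ Ω) {a b : E} (hab : segment ℝ a b ⊆ ψ.target)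
    (ha : ψ.symm a ∈ φ.source)
    (hball : Metric.closedBall (φ (ψ.symm a)) (K * ‖b - a‖) ⊆ φ.target) :
    ψ.symm b ∈ φ.source := by
  let y : ℝ → E := fun t => a + t • (b - a)
  have hy : ∀ t ∈ Icc (0 : ℝ) 1, y t ∈ ψ.target := fun t ht =>
    hab (by rw [segment_eq_image']; exact mem_image_of_mem _ ht)
  have hyc : Continuous y := by fun_prop
  have hγc : ContinuousOn (fun t => ψ.symm (y t)) (Icc 0 1) :=
    ψ.continuousOn_symm.comp hyc.continuousOn hy
  by_contra hbad
  let B : Set ℝ := Icc 0 1 ∩ (fun t => ψ.symm (y t)) ⁻¹' φ.sourceᶜ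
  have hBc : IsCompact B := isCompact_Icc.of_isClosed_subset
    (hγc.preimage_isClosed_of_isClosed isClosed_Icc φ.open_source.isClosed_compl) inter_subset_left
  have hy1 : y 1 = b := by simp [y]
  have hy0 : y 0 = a := by simp [y]
  -- Let `t` be the first time outside the domain of `φ`. Before `t` the path read in `φ` is
  -- Lipschitz with constant `K * ‖b - a‖`, so by completeness it has a limit `z` at `t`, inside the
  -- closed ball of `hball`.
  obtain ⟨t, htB, hleast⟩ := hBc.exists_isLeast ⟨1, ⟨by simp, by simpa [hy1] using hbad⟩⟩
  have ht0 : 0 < t := by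
    refine lt_of_le_of_ne htB.1.1 fun h => htB.2 ?_
    rw [← h]; simpa [hy0] using ha
  have hgood : ∀ s ∈ Ico 0 t, ψ.symm (y s) ∈ φ.source := by
    intro s hs
    by_contra hcon
    exact absurd (hleast ⟨⟨hs.1, hs.2.le.trans htB.1.2⟩, hcon⟩) (not_le.2 hs.2)
  have hI : ∀ s ∈ Ico 0 t, s ∈ Icc (0 : ℝ) 1 := fun s hs => ⟨hs.1, hs.2.le.trans htB.1.2⟩
  let f : ℝ → E := fun s => (φ ∘ ψ.symm) (y s)
  have hG : ∀ s ∈ Ico 0 t, y s ∈ (ψ.symm.trans φ).source := fun s hs => by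
    rw [OpenPartialHomeomorph.trans_source, OpenPartialHomeomorph.symm_source]
    exact ⟨hy s (hI s hs), hgood s hs⟩
  have hderiv : ∀ s ∈ Ico 0 t, HasDerivWithinAt f
      (fderiv ℝ (φ ∘ ψ.symm) (y s) (b - a)) (Ico 0 t) s := by
    intro s hs
    have h1 : HasDerivAt y (b - a) s := by
      have h := ((hasDerivAt_id s).smul_const (b - a)).const_add a
      rwa [one_smul] at h
    have h2 := ((contDiffAt_transition (hΩ.mem_maximalAtlas hψ) (hΩ.mem_maximalAtlas hφ)
      (hG s hs)).differentiableAt two_ne_zero).hasFDerivAt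
    exact (h2.comp_hasDerivAt s h1).hasDerivWithinAt
  have hlip : ∀ s ∈ Ico 0 t, ∀ r ∈ Ico 0 t, ‖f r - f s‖ ≤ K * ‖b - a‖ * ‖r - s‖ :=
    fun s hs r hr => (convex_Ico 0 t).norm_image_sub_le_of_norm_hasDerivWithin_le hderiv
      (fun s hs => ((ContinuousLinearMap.le_opNorm _ _).trans
        (mul_le_mul_of_nonneg_right (hK ψ hψ φ hφ _ (hG s hs)) (norm_nonneg _)))) hs hr
  have hK0 : 0 ≤ K := (norm_nonneg _).trans (hK ψ hψ φ hφ _ (hG 0 ⟨le_rfl, ht0⟩))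
  have hunif : UniformContinuousOn f (Ico 0 t) := by
    have : LipschitzOnWith (K * ‖b - a‖).toNNReal f (Ico 0 t) :=
      LipschitzOnWith.of_dist_le_mul fun r hr s hs => by
        rw [dist_eq_norm, dist_eq_norm, Real.coe_toNNReal _ (by positivity)]
        exact hlip s hs r hr
    exact this.uniformContinuousOn
  have hne : (𝓝[Ico 0 t] t).NeBot := by
    rw [← mem_closure_iff_nhdsWithin_neBot, closure_Ico ht0.ne]
    exact ⟨ht0.le, le_rfl⟩
  have hcauchy : Cauchy (map f (𝓝[Ico 0 t] t)) :=
    (cauchy_nhds.mono nhdsWithin_le_nhds).map_of_le hunif inf_le_right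
  obtain ⟨z, hz⟩ := CompleteSpace.complete hcauchy
  have hzt : z ∈ φ.target := by
    refine hball (Metric.isClosed_closedBall.mem_of_tendsto hz ?_)
    filter_upwards [self_mem_nhdsWithin] with s hs
    have := hlip 0 ⟨le_rfl, ht0⟩ s hs
    rw [Metric.mem_closedBall, dist_eq_norm]
    have hf0 : f 0 = φ (ψ.symm a) := by simp [f, hy0]
    rw [← hf0]
    refine this.trans (mul_le_of_le_one_right (by positivity) ?_)
    rw [sub_zero, Real.norm_of_nonneg hs.1]
    exact (hI s hs).2
  have h1 : Tendsto (fun s => φ.symm (f s)) (𝓝[Ico 0 t] t) (𝓝 (φ.symm z)) :=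
    (φ.continuousAt_symm hzt).tendsto.comp hz
  have h2 : Tendsto (fun s => ψ.symm (y s)) (𝓝[Ico 0 t] t) (𝓝 (ψ.symm (y t))) :=
    (hγc t htB.1).mono hI
  have h3 : (fun s => φ.symm (f s)) =ᶠ[𝓝[Ico 0 t] t] fun s => ψ.symm (y s) := by
    filter_upwards [self_mem_nhdsWithin] with s hs
    exact φ.left_inv (hgood s hs)
  -- By uniqueness of limits in `M`, the point at time `t` is `φ.symm z`, which lies in the domain
  -- of `φ`: a contradiction.
  refine htB.2 ?_
  change ψ.symm (y t) ∈ φ.source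
  rw [tendsto_nhds_unique h2 (h1.congr' h3)]
  exact φ.map_target hzt

/-- A point of the closure is joined to a nearby point of the set by a short segment in another
chart. Read in `φ`, this path moves by less than `R - r`, so it cannot leave the chart domain.
Continuity of `φ` does the rest. -/
theorem IsBoundedAtlas.isClosed_preimage_closedBall [CompleteSpace E] [T2Space M]
    (hΩ : IsBoundedAtlas Ω) {φ : OpenPartialHomeomorph M E} (hφ : φ ∈ Ω) {x : E} {r R : ℝ}
    (hrR : r < R) (hR : Metric.ball x R ⊆ φ.target) :
    IsClosed (φ.source ∩ φ ⁻¹' Metric.closedBall x r) := by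
  obtain ⟨K, hK0, hK⟩ := hΩ.bounded
  refine isClosed_of_closure_subset fun q hq => ?_
  obtain ⟨ψ, hψ, hqψ⟩ := hΩ.covers q
  obtain ⟨δ, hδ, hball⟩ := Metric.nhds_basis_ball.mem_iff.1
    (ψ.open_target.mem_nhds (ψ.map_source hqψ))
  -- The bound `δ` keeps the segment in the chart `ψ`; the bound `(R - r) / K` keeps its image in
  -- `φ` inside the ball of radius `R`.
  let η : ℝ := min δ ((R - r) / K)
  have hη : 0 < η := lt_min hδ (div_pos (sub_pos.2 hrR) hK0)
  have hnhds : ψ.source ∩ ψ ⁻¹' Metric.ball (ψ q) η ∈ 𝓝 q :=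
    (ψ.isOpen_inter_preimage Metric.isOpen_ball).mem_nhds ⟨hqψ, Metric.mem_ball_self hη⟩
  obtain ⟨q', ⟨hq'ψ, hq'b⟩, hq'φ, hq'r⟩ := mem_closure_iff_nhds.1 hq _ hnhds
  have hqs : q ∈ φ.source := by
    have := hΩ.mem_source_of_segment (fun φ hφ ψ hψ x hx => (hK φ hφ ψ hψ x hx).1) hφ hψ
      (a := ψ q') (b := ψ q) ?_ ?_ ?_
    · rwa [ψ.left_inv hqψ] at this
    · exact ((convex_ball (ψ q) η).segment_subset hq'b (Metric.mem_ball_self hη)).trans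
        ((Metric.ball_subset_ball (min_le_left _ _)).trans hball)
    · rwa [ψ.left_inv hq'ψ]
    · rw [ψ.left_inv hq'ψ]
      refine Subset.trans (fun z hz => ?_) hR
      rw [Metric.mem_closedBall] at hz
      have h1 : K * ‖ψ q - ψ q'‖ < R - r := by
        rw [mem_preimage, Metric.mem_ball', dist_eq_norm] at hq'b
        rw [← lt_div_iff₀' hK0]
        exact hq'b.trans_le (min_le_right _ _)
      have h2 : dist (φ q') x ≤ r := hq'r
      rw [Metric.mem_ball]
      linarith [dist_triangle z (φ q') x]
  refine ⟨hqs, ?_⟩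
  have h1 : Tendsto φ (𝓝[φ.source ∩ φ ⁻¹' Metric.closedBall x r] q) (𝓝 (φ q)) :=
    (φ.continuousAt hqs).tendsto.mono_left nhdsWithin_le_nhds
  have := mem_closure_iff_nhdsWithin_neBot.1 hq
  exact Metric.isClosed_closedBall.mem_of_tendsto h1
    (by filter_upwards [self_mem_nhdsWithin] with s hs using hs.2)

/-- The segment read through `φ.symm` is a competing curve; in any chart `ψ` its velocity is the
derivative of a transition map applied to `b - a`. -/
theorem IsBoundedAtlas.intrinsicEDist_le (hΩ : IsBoundedAtlas Ω) {K : ℝ}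
    (hK : ∀ φ ∈ Ω, ∀ ψ ∈ Ω, ∀ x ∈ (φ.symm.trans ψ).source, ‖fderiv ℝ (ψ ∘ φ.symm) x‖ ≤ K)
    {φ : OpenPartialHomeomorph M E} (hφ : φ ∈ Ω) {a b : E} (hab : segment ℝ a b ⊆ φ.target) :
    intrinsicEDist Ω (φ.symm a) (φ.symm b) ≤ ENNReal.ofReal (K * ‖b - a‖) := by
  let y : ℝ → E := fun t => a + t • (b - a)
  have hy : ∀ t ∈ Icc (0 : ℝ) 1, y t ∈ φ.target := fun t ht =>
    hab (by rw [segment_eq_image']; exact mem_image_of_mem _ ht)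
  have hyc : ContDiff ℝ 1 y := by fun_prop
  have hφm := hΩ.mem_maximalAtlas hφ
  have hsm : ContMDiffOn 𝓘(ℝ, ℝ) 𝓘(ℝ, E) 1 (fun t => φ.symm (y t)) (Icc 0 1) :=
    ((contMDiffOn_symm_of_mem_maximalAtlas hφm).of_le (by norm_num)).comp
      hyc.contMDiff.contMDiffOn hy
  refine (iInf₂_le (fun t => φ.symm (y t)) ⟨⟨hsm.continuousOn, ∅, fun c d _ hcd _ =>
    hsm.mono hcd⟩, by simp [y], by simp [y]⟩).trans ?_
  have hbound : ∀ t ∈ Icc (0 : ℝ) 1, tangentENorm Ω (φ.symm (y t))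
      (mfderiv 𝓘(ℝ, ℝ) 𝓘(ℝ, E) (fun t => φ.symm (y t)) t (1 : ℝ)) ≤
        ENNReal.ofReal (K * ‖b - a‖) := by
    intro t ht
    refine iSup₂_le fun ψ hψ => iSup_le fun hp => ?_
    have hG : y t ∈ (φ.symm.trans ψ).source := by
      rw [OpenPartialHomeomorph.trans_source, OpenPartialHomeomorph.symm_source]
      exact ⟨hy t ht, hp⟩
    have h1 : HasDerivAt y (b - a) t := by
      have h := ((hasDerivAt_id t).smul_const (b - a)).const_add a
      rwa [one_smul] at h
    have h2 : mfderiv 𝓘(ℝ, ℝ) 𝓘(ℝ, E) (fun t => φ.symm (y t)) t =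
        (mfderiv 𝓘(ℝ, E) 𝓘(ℝ, E) φ.symm (y t)).comp (mfderiv 𝓘(ℝ, ℝ) 𝓘(ℝ, E) y t) :=
      mfderiv_comp t (mdifferentiableAt_symm_of_mem_maximalAtlas hφm (hy t ht))
        h1.differentiableAt.mdifferentiableAt
    have h3 : mfderiv 𝓘(ℝ, ℝ) 𝓘(ℝ, E) y t (1 : ℝ) = b - a := by
      have h : fderiv ℝ y t (1 : ℝ) = b - a := fderiv_apply_one_eq_deriv.trans h1.deriv
      rw [mfderiv_eq_fderiv]
      exact h
    have h4 : mfderiv 𝓘(ℝ, E) 𝓘(ℝ, E) ψ (φ.symm (y t))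
        (mfderiv 𝓘(ℝ, ℝ) 𝓘(ℝ, E) (fun t => φ.symm (y t)) t (1 : ℝ)) =
          fderiv ℝ (ψ ∘ φ.symm) (y t) (b - a) := by
      rw [← mfderiv_comp_mfderiv_symm hφm (hΩ.mem_maximalAtlas hψ) hG, ← h3, h2]
      rfl
    rw [h4, ← ofReal_norm]
    exact ENNReal.ofReal_le_ofReal ((ContinuousLinearMap.le_opNorm _ _).trans
      (mul_le_mul_of_nonneg_right (hK φ hφ ψ hψ _ hG) (norm_nonneg _)))
  refine (setLIntegral_mono measurable_const hbound).trans ?_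
  simp

theorem IsBoundedAtlas.isRhoBounded_of_subset (hΩ : IsBoundedAtlas Ω)
    {φ : OpenPartialHomeomorph M E} (hφ : φ ∈ Ω) {x : E} {r : ℝ}
    (hr : Metric.closedBall x r ⊆ φ.target) {S : Set M}
    (hS : S ⊆ φ.source ∩ φ ⁻¹' Metric.closedBall x r) : IsRhoBounded Ω S := by
  obtain ⟨K, hK0, hK⟩ := hΩ.bounded
  refine ⟨K * (r + r), fun p hp q hq => ?_⟩
  have h := hΩ.intrinsicEDist_le (fun φ hφ ψ hψ x hx => (hK φ hφ ψ hψ x hx).1) hφ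
    (((convex_closedBall x r).segment_subset (hS hp).2 (hS hq).2).trans hr)
  rw [φ.left_inv (hS hp).1, φ.left_inv (hS hq).1] at h
  refine h.trans (ENNReal.ofReal_le_ofReal (mul_le_mul_of_nonneg_left ?_ hK0.le))
  rw [← dist_eq_norm]
  have h1 : dist (φ p) x ≤ r := (hS hp).2
  have h2 : dist (φ q) x ≤ r := (hS hq).2
  linarith [dist_triangle_right (φ q) (φ p) x]

end Topology

/-! ### Test forms supported in one chart -/

section PullbackForm

variable {E : Type*} [NormedAddCommGroup E] [NormedSpace ℝ E]
variable {M : Type*} [TopologicalSpace M] [ChartedSpace E M]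
variable {Ω : Set (OpenPartialHomeomorph M E)} {k : ℕ}

open Classical in
/-- The differential form `φ^*(v α)`, extended by zero outside the chart domain. -/
def pullbackForm (φ : OpenPartialHomeomorph M E) (v : E → ℝ) (α : E [⋀^Fin k]→L[ℝ] ℝ) :
    DiffForm E M k := fun p =>
  if p ∈ φ.source then
    v (φ p) • ContinuousAlternatingMap.compContinuousLinearMap (M := E)
      (M' := TangentSpace 𝓘(ℝ, E) p) α (mfderiv 𝓘(ℝ, E) 𝓘(ℝ, E) φ p)
  else 0

theorem pairing_pullbackForm_of_mem (φ : OpenPartialHomeomorph M E) (v : E → ℝ)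
    (α : E [⋀^Fin k]→L[ℝ] ℝ) {p : M} (hp : p ∈ φ.source) (ξ : ⋀[ℝ]^k (TangentSpace 𝓘(ℝ, E) p)) :
    pairing (pullbackForm φ v α p) ξ = v (φ p) * pairing (T := E) α
      (exteriorPower.map (N := E) k (mfderiv 𝓘(ℝ, E) 𝓘(ℝ, E) φ p).toLinearMap ξ) := by
  rw [pullbackForm, if_pos hp, pairing_smul]
  congr 1
  exact pairing_compContinuousLinearMap (T := TangentSpace 𝓘(ℝ, E) p) (T' := E) α _ ξ

theorem pairing_pullbackForm_of_notMem (φ : OpenPartialHomeomorph M E) (v : E → ℝ)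
    (α : E [⋀^Fin k]→L[ℝ] ℝ) {p : M} (hp : p ∉ φ.source) (ξ : ⋀[ℝ]^k (TangentSpace 𝓘(ℝ, E) p)) :
    pairing (pullbackForm φ v α p) ξ = 0 := by
  rw [pullbackForm, if_neg hp, pairing_zero]

theorem localRep_pullbackForm {φ ψ : OpenPartialHomeomorph M E}
    (hφ : φ ∈ IsManifold.maximalAtlas 𝓘(ℝ, E) 2 M)
    (hψ : ψ ∈ IsManifold.maximalAtlas 𝓘(ℝ, E) 2 M) (v : E → ℝ) (α : E [⋀^Fin k]→L[ℝ] ℝ) {y : E}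
    (hy : y ∈ (ψ.symm.trans φ).source) :
    (pullbackForm φ v α).localRep ψ y =
      v ((φ ∘ ψ.symm) y) • α.compContinuousLinearMap (fderiv ℝ (φ ∘ ψ.symm) y) := by
  have hy' := hy
  rw [OpenPartialHomeomorph.trans_source, OpenPartialHomeomorph.symm_source] at hy'
  have hp : ψ.symm y ∈ φ.source := hy'.2
  rw [← mfderiv_comp_mfderiv_symm hψ hφ hy, DiffForm.localRep, pullbackForm, if_pos hp]
  rfl

/-- Near a point of the domain of `φ`, the local representation in another chart is a pullback by a
transition map, with bounds independent of the chart. At any other point the form vanishes nearby,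
because its support lies in the closed preimage of the ball. -/
theorem IsBoundedAtlas.isC01_pullbackForm [CompleteSpace E] [T2Space M] (hΩ : IsBoundedAtlas Ω)
    {φ : OpenPartialHomeomorph M E} (hφ : φ ∈ Ω) {x : E} {r R : ℝ} (hrR : r < R)
    (hR : Metric.ball x R ⊆ φ.target) {v : E → ℝ} (hv : IsBoundedC1 v)
    (hsupp : ∀ y, v y ≠ 0 → y ∈ Metric.closedBall x r) (α : E [⋀^Fin k]→L[ℝ] ℝ) :
    (pullbackForm φ v α : DiffForm E M k).IsC01 Ω := by
  have hclosed := hΩ.isClosed_preimage_closedBall hφ hrR hR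
  have hzero : ∀ p ∉ φ.source ∩ φ ⁻¹' Metric.closedBall x r,
      (pullbackForm φ v α : DiffForm E M k) p = 0 := by
    intro p hp
    by_cases hs : p ∈ φ.source
    · have : v (φ p) = 0 := by
        by_contra h
        exact hp ⟨hs, hsupp _ h⟩
      rw [pullbackForm, if_pos hs, this, zero_smul]
    · rw [pullbackForm, if_neg hs]
  obtain ⟨K₀, hK₀, hK⟩ := hΩ.bounded
  obtain ⟨C, hC⟩ := hv.2
  have hC0 : 0 ≤ C := (norm_nonneg _).trans (hC 0).1
  let K : ℝ := max K₀ 1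
  have hK1 : 1 ≤ K := le_max_right _ _
  have hK0 : 0 ≤ K := zero_le_one.trans hK1
  have hloc : ∀ ψ ∈ Ω, ∀ y ∈ ψ.target,
      ContDiffAt ℝ 1 ((pullbackForm φ v α : DiffForm E M k).localRep ψ) y ∧
      ‖(pullbackForm φ v α : DiffForm E M k).localRep ψ y‖ ≤ C * (‖α‖ * K ^ k) ∧
      ‖fderiv ℝ ((pullbackForm φ v α : DiffForm E M k).localRep ψ) y‖ ≤
        C * (k * (‖α‖ * K ^ k) * K) + C * K * (‖α‖ * K ^ k) := by
    intro ψ hψ y hy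
    by_cases hG : y ∈ (ψ.symm.trans φ).source
    · have heq : (pullbackForm φ v α : DiffForm E M k).localRep ψ =ᶠ[𝓝 y] fun y =>
          v ((φ ∘ ψ.symm) y) • α.compContinuousLinearMap (fderiv ℝ (φ ∘ ψ.symm) y) := by
        filter_upwards [(ψ.symm.trans φ).open_source.mem_nhds hG] with z hz
        exact localRep_pullbackForm (hΩ.mem_maximalAtlas hφ) (hΩ.mem_maximalAtlas hψ) v α hz
      have := contDiffAt_and_norm_le_of_pullback hv.1 hC α
        (contDiffAt_transition (hΩ.mem_maximalAtlas hψ) (hΩ.mem_maximalAtlas hφ) hG) hK1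
        ((hK ψ hψ φ hφ y hG).1.trans (le_max_left _ _))
        ((hK ψ hψ φ hφ y hG).2.trans (le_max_left _ _))
      rw [heq.fderiv_eq, heq.eq_of_nhds]
      exact ⟨this.1.congr_of_eventuallyEq heq, this.2⟩
    · have hyS : ψ.symm y ∉ φ.source ∩ φ ⁻¹' Metric.closedBall x r := by
        intro h
        refine hG ?_
        rw [OpenPartialHomeomorph.trans_source, OpenPartialHomeomorph.symm_source]
        exact ⟨hy, h.1⟩
      have heq : (pullbackForm φ v α : DiffForm E M k).localRep ψ =ᶠ[𝓝 y] fun _ => 0 := by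
        filter_upwards [(ψ.continuousAt_symm hy).preimage_mem_nhds
          (hclosed.isOpen_compl.mem_nhds hyS)] with z hz
        rw [DiffForm.localRep, hzero _ hz]
        rfl
      rw [heq.fderiv_eq, heq.eq_of_nhds]
      refine ⟨contDiffAt_const.congr_of_eventuallyEq heq, ?_, ?_⟩
      · rw [norm_zero]; positivity
      · rw [fderiv_fun_const, Pi.zero_apply]
        exact (norm_zero (E := E →L[ℝ] E [⋀^Fin k]→L[ℝ] ℝ)).trans_le (by positivity)
  refine ⟨⟨fun ψ hψ y hy => (hloc ψ hψ y hy).1.contDiffWithinAt,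
    max (C * (‖α‖ * K ^ k)) (C * (k * (‖α‖ * K ^ k) * K) + C * K * (‖α‖ * K ^ k)),
    fun ψ hψ y hy => ⟨(hloc ψ hψ y hy).2.1.trans (le_max_left _ _),
      (hloc ψ hψ y hy).2.2.trans (le_max_right _ _)⟩⟩, ?_⟩
  refine hΩ.isRhoBounded_of_subset hφ
    ((Metric.closedBall_subset_ball hrR).trans hR) (closure_minimal (fun p hp => ?_) hclosed)
  by_contra h
  exact hp (hzero p h)

end PullbackForm

/-- A separable subset of a dual space is separated from zero by countably many vectors. -/
theorem exists_countable_separating {F : Type*} [NormedAddCommGroup F] [NormedSpace ℝ F]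
    {S : Set (StrongDual ℝ F)} (hS : TopologicalSpace.IsSeparable S) :
    ∃ A : Set F, A.Countable ∧ ∀ η ∈ closure S, (∀ a ∈ A, η a = 0) → η = 0 := by
  obtain ⟨C, hC, hSC⟩ := hS
  have hex : ∀ c : StrongDual ℝ F, ∃ a : F, ‖a‖ ≤ 1 ∧ ‖c‖ ≤ 2 * ‖c a‖ := by
    intro c
    rcases eq_or_ne c 0 with rfl | hc
    · exact ⟨0, by simp, by simp⟩
    · obtain ⟨a, ha, h⟩ := c.exists_lt_apply_of_lt_opNorm (half_lt_self (norm_pos_iff.2 hc))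
      exact ⟨a, ha.le, by linarith⟩
  choose a ha hca using hex
  refine ⟨a '' C, hC.image a, fun η hη h0 => ?_⟩
  have hη' : η ∈ closure C := closure_minimal hSC isClosed_closure hη
  by_contra hne
  have hpos : 0 < ‖η‖ := norm_pos_iff.2 hne
  -- Since `η` kills `a c`, `‖c‖ ≤ 2 * ‖c (a c)‖ ≤ 2 * ‖η - c‖`, so `‖η‖ ≤ 3 * ‖η - c‖`; a distance
  -- below `‖η‖ / 3` is contradictory.
  obtain ⟨c, hc, hd⟩ := Metric.mem_closure_iff.1 hη' (‖η‖ / 3) (by positivity)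
  rw [dist_eq_norm] at hd
  have h1 : ‖c (a c)‖ ≤ ‖η - c‖ := by
    have : c (a c) = -((η - c) (a c)) := by
      simp [h0 _ (mem_image_of_mem a hc)]
    rw [this, norm_neg]
    exact ((η - c).le_opNorm _).trans (mul_le_of_le_one_right (norm_nonneg _) (ha c))
  have h2 : ‖η‖ ≤ ‖η - c‖ + ‖c‖ := by simpa using norm_add_le (η - c) c
  linarith [hca c]

/-! ### Measurable multivector fields and their vanishing -/

section Fields

variable {E : Type*} [NormedAddCommGroup E] [NormedSpace ℝ E]
variable {M : Type*} [TopologicalSpace M] [ChartedSpace E M]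
variable {Ω : Set (OpenPartialHomeomorph M E)} {k : ℕ}

variable (E k) in
/-- The bidual norm space of `⋀ᵏ E`. -/
def Bidual : Type _ := StrongDual ℝ (E [⋀^Fin k]→L[ℝ] ℝ)

instance : NormedAddCommGroup (Bidual E k) :=
  inferInstanceAs (NormedAddCommGroup (StrongDual ℝ (E [⋀^Fin k]→L[ℝ] ℝ)))

instance : NormedSpace ℝ (Bidual E k) :=
  inferInstanceAs (NormedSpace ℝ (StrongDual ℝ (E [⋀^Fin k]→L[ℝ] ℝ)))

theorem continuous_flipAlternating :
    Continuous fun v : Fin k → E => (show Bidual E k from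
      (ContinuousLinearMap.id ℝ (E [⋀^Fin k]→L[ℝ] ℝ)).flipAlternating v) :=
  (ContinuousLinearMap.id ℝ (E [⋀^Fin k]→L[ℝ] ℝ)).flipAlternating.toContinuousMultilinearMap.cont

/-- The representation of a `k`-vector at `p` in the chart `φ`, as a functional on the bounded
alternating `k`-forms. -/
def chartBidual (φ : OpenPartialHomeomorph M E) (p : M) :
    ⋀[ℝ]^k (TangentSpace 𝓘(ℝ, E) p) →ₗ[ℝ] Bidual E k :=
  (show ⋀[ℝ]^k E →ₗ[ℝ] Bidual E k from toBidual E k) ∘ₗ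
    exteriorPower.map (N := E) k (mfderiv 𝓘(ℝ, E) 𝓘(ℝ, E) φ p).toLinearMap

theorem kVectorENorm_eq_iSup_chartBidual (p : M) (ξ : ⋀[ℝ]^k (TangentSpace 𝓘(ℝ, E) p)) :
    kVectorENorm Ω p ξ = ⨆ (φ ∈ Ω) (_ : p ∈ φ.source), ‖chartBidual φ p ξ‖ₑ := by
  unfold kVectorENorm
  refine iSup_congr fun φ => iSup_congr fun _ => iSup_congr fun _ => ?_
  exact wedgeENorm_eq_enorm_toBidual (E := E) _

theorem enorm_chartBidual_le_kVectorENorm {φ : OpenPartialHomeomorph M E} (hφ : φ ∈ Ω) {p : M}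
    (hp : p ∈ φ.source) (ξ : ⋀[ℝ]^k (TangentSpace 𝓘(ℝ, E) p)) :
    ‖chartBidual φ p ξ‖ₑ ≤ kVectorENorm Ω p ξ := by
  rw [kVectorENorm_eq_iSup_chartBidual]
  exact le_iSup₂_of_le φ hφ (le_iSup_of_le hp le_rfl)

theorem kVectorENorm_add_le (p : M) (ξ η : ⋀[ℝ]^k (TangentSpace 𝓘(ℝ, E) p)) :
    kVectorENorm Ω p (ξ + η) ≤ kVectorENorm Ω p ξ + kVectorENorm Ω p η := by
  rw [kVectorENorm_eq_iSup_chartBidual]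
  refine iSup₂_le fun φ hφ => iSup_le fun hp => ?_
  rw [map_add]
  exact (enorm_add_le _ _).trans (add_le_add (enorm_chartBidual_le_kVectorENorm hφ hp ξ)
    (enorm_chartBidual_le_kVectorENorm hφ hp η))

theorem kVectorENorm_smul_le (p : M) (c : ℝ) (ξ : ⋀[ℝ]^k (TangentSpace 𝓘(ℝ, E) p)) :
    kVectorENorm Ω p (c • ξ) ≤ ‖c‖ₑ * kVectorENorm Ω p ξ := by
  rw [kVectorENorm_eq_iSup_chartBidual]
  refine iSup₂_le fun φ hφ => iSup_le fun hp => ?_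
  rw [map_smul, enorm_smul]
  exact mul_le_mul_right (enorm_chartBidual_le_kVectorENorm hφ hp ξ) _

theorem kVectorENorm_neg (p : M) (ξ : ⋀[ℝ]^k (TangentSpace 𝓘(ℝ, E) p)) :
    kVectorENorm Ω p (-ξ) = kVectorENorm Ω p ξ := by
  simp only [kVectorENorm_eq_iSup_chartBidual, map_neg, enorm_neg]

theorem kVectorENorm_zero (p : M) :
    kVectorENorm Ω p (0 : ⋀[ℝ]^k (TangentSpace 𝓘(ℝ, E) p)) = 0 := by
  simp [kVectorENorm_eq_iSup_chartBidual]

theorem chartBidual_injective {φ : OpenPartialHomeomorph M E}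
    (hφ : φ ∈ IsManifold.maximalAtlas 𝓘(ℝ, E) 2 M) {p : M} (hp : p ∈ φ.source) :
    Function.Injective (chartBidual (k := k) φ p) := by
  refine toBidual_injective.comp (exteriorPower.map_injective
    (mfderiv 𝓘(ℝ, E) 𝓘(ℝ, E) φ.symm (φ p)).toLinearMap ?_)
  ext ξ
  exact congrArg (fun L : TangentSpace 𝓘(ℝ, E) p →L[ℝ] TangentSpace 𝓘(ℝ, E) p => L ξ)
    (mfderiv_symm_comp_mfderiv hφ hp)

theorem IsBoundedAtlas.eq_zero_of_kVectorENorm_eq_zero (hΩ : IsBoundedAtlas Ω) {p : M}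
    {ξ : ⋀[ℝ]^k (TangentSpace 𝓘(ℝ, E) p)} (h : kVectorENorm Ω p ξ = 0) : ξ = 0 := by
  obtain ⟨φ, hφ, hp⟩ := hΩ.covers p
  have h1 := enorm_chartBidual_le_kVectorENorm hφ hp ξ
  rw [h, nonpos_iff_eq_zero, enorm_eq_zero] at h1
  exact chartBidual_injective (hΩ.mem_maximalAtlas hφ) hp (h1.trans (map_zero _).symm)

theorem continuousOn_chartBidual {Y : KVectorField E M k} (hY : Y ∈ ContinuousKVectorFields Ω k)
    {φ : OpenPartialHomeomorph M E} (hφ : φ ∈ Ω) :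
    ContinuousOn (fun p => chartBidual φ p (Y p)) φ.source := by
  induction hY using Submodule.span_induction with
  | mem Y hY =>
    obtain ⟨f, X, hf, hX, rfl⟩ := hY
    have h1 : ∀ i, ContinuousOn (fun p => (X i).localRep φ (φ p)) φ.source := fun i =>
      (hX i φ hφ).comp φ.continuousOn fun p hp => φ.map_source hp
    have h2 : ContinuousOn (fun p => f p • (show Bidual E k from
        (ContinuousLinearMap.id ℝ (E [⋀^Fin k]→L[ℝ] ℝ)).flipAlternating
          (fun i => (X i).localRep φ (φ p)))) φ.source :=
      hf.continuousOn.smul (continuous_flipAlternating.comp_continuousOn (continuousOn_pi.2 h1))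
    refine h2.congr fun p hp => ?_
    -- The tangent space depends on the base point, so `φ.symm (φ p)` is replaced by `p` through a
    -- separate variable `q`.
    have h3 : ∀ i, ∀ q, q = p → (mfderiv 𝓘(ℝ, E) 𝓘(ℝ, E) φ q (X i q) : E) =
        mfderiv 𝓘(ℝ, E) 𝓘(ℝ, E) φ p (X i p) := by
      rintro i _ rfl; rfl
    have h4 : ∀ i, (X i).localRep φ (φ p) = mfderiv 𝓘(ℝ, E) 𝓘(ℝ, E) φ p (X i p) := fun i =>
      h3 i _ (φ.left_inv hp)
    simp only [decomposable, map_smul, h4]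
    congr 1
    refine (congrArg (toBidual E k) (exteriorPower.map_apply_ιMulti (N := E)
      (mfderiv 𝓘(ℝ, E) 𝓘(ℝ, E) φ p).toLinearMap _)).trans ?_
    exact toBidual_ιMulti _
  | zero => simpa using continuousOn_const
  | add Y Y' _ _ h h' => simpa [Function.comp_def] using h.fun_add h'
  | smul c Y _ h => simpa using h.fun_const_smul c

/-- Each chart contributes a function continuous on its open domain and zero elsewhere, hence lower
semicontinuous. Suprema preserve this even for uncountable atlases, whereas measurability alone
would be lost. -/
theorem lowerSemicontinuous_kVectorENorm {Y : KVectorField E M k}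
    (hY : Y ∈ ContinuousKVectorFields Ω k) :
    LowerSemicontinuous fun p => kVectorENorm Ω p (Y p) := by
  simp only [kVectorENorm_eq_iSup_chartBidual]
  refine lowerSemicontinuous_biSup fun φ hφ p c hc => ?_
  change c < ⨆ (_ : p ∈ φ.source), ‖chartBidual φ p (Y p)‖ₑ at hc
  change ∀ᶠ q in 𝓝 p, c < ⨆ (_ : q ∈ φ.source), ‖chartBidual φ q (Y q)‖ₑ
  by_cases hp : p ∈ φ.source
  · have h1 : ContinuousAt (fun p => ‖chartBidual φ p (Y p)‖ₑ) p :=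
      (((continuousOn_chartBidual hY hφ).continuousAt (φ.open_source.mem_nhds hp))).enorm
    rw [iSup_pos hp] at hc
    filter_upwards [h1.eventually (lt_mem_nhds hc), φ.open_source.mem_nhds hp] with q hq hqs
    rwa [iSup_pos hqs]
  · rw [iSup_neg hp] at hc
    exact absurd hc not_lt_bot

/-- On a compact part of a chart domain countably many forms suffice to detect whether the limit
of a sequence of continuous fields vanishes. -/
theorem exists_countable_forms (hΩ : IsBoundedAtlas Ω) {Y : ℕ → KVectorField E M k}
    (hY : ∀ n, Y n ∈ ContinuousKVectorFields Ω k) {φ : OpenPartialHomeomorph M E} (hφ : φ ∈ Ω)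
    {L : Set M} (hL : IsCompact L) (hLs : L ⊆ φ.source) :
    ∃ A : Set (E [⋀^Fin k]→L[ℝ] ℝ), A.Countable ∧
      ∀ p ∈ L, ∀ ξ : ⋀[ℝ]^k (TangentSpace 𝓘(ℝ, E) p),
        Tendsto (fun n => kVectorENorm Ω p (Y n p - ξ)) atTop (𝓝 0) →
        (∀ α ∈ A, pairing (T := E) α (exteriorPower.map (N := E) k
          (mfderiv 𝓘(ℝ, E) 𝓘(ℝ, E) φ p).toLinearMap ξ) = 0) → ξ = 0 := by
  have hS : TopologicalSpace.IsSeparable (⋃ n, (fun p => chartBidual φ p (Y n p)) '' L) :=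
    TopologicalSpace.isSeparable_iUnion.2 fun n =>
      (hL.image_of_continuousOn ((continuousOn_chartBidual (hY n) hφ).mono hLs)).isSeparable
  obtain ⟨A, hA, h⟩ := exists_countable_separating hS
  refine ⟨A, hA, fun p hp ξ hξ h0 => ?_⟩
  refine chartBidual_injective (hΩ.mem_maximalAtlas hφ) (hLs hp) ?_
  rw [map_zero]
  have hlim : Tendsto (fun n => chartBidual φ p (Y n p)) atTop (𝓝 (chartBidual φ p ξ)) := by
    rw [tendsto_iff_edist_tendsto_0]
    refine tendsto_of_tendsto_of_tendsto_of_le_of_le tendsto_const_nhds hξ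
      (fun _ => zero_le) fun n => ?_
    simp only [edist_eq_enorm_sub, ← map_sub]
    exact enorm_chartBidual_le_kVectorENorm hφ (hLs hp) _
  have hmem : chartBidual φ p ξ ∈ closure (⋃ n, (fun p => chartBidual φ p (Y n p)) '' L) :=
    mem_closure_of_tendsto hlim
      (Eventually.of_forall fun n => mem_iUnion.2 ⟨n, mem_image_of_mem _ hp⟩)
  exact h _ hmem fun α hα => (toBidual_apply _ α).trans (h0 α hα)

variable [MeasurableSpace M] {μ : Measure M}

/-- Measurability is all that is needed from the `L₁` condition: integrability of the pairings is
part of being a divergence. -/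
theorem isMeasurableField_of_mem_L1KVectorFields {W : KVectorField E M k}
    (hW : W ∈ L1KVectorFields Ω μ k) : IsMeasurableField Ω μ W := by
  induction hW using Submodule.span_induction with
  | mem W hW => exact hW.1.1
  | zero => exact ⟨0, fun _ => zero_mem _, Eventually.of_forall fun p => by
      simp [kVectorENorm_zero]⟩
  | add W W' _ _ h h' =>
    obtain ⟨Y, hY, h⟩ := h
    obtain ⟨Y', hY', h'⟩ := h'
    refine ⟨fun n => Y n + Y' n, fun n => add_mem (hY n) (hY' n), ?_⟩
    filter_upwards [h, h'] with p hp hp'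
    have := hp.add hp'
    rw [add_zero] at this
    refine tendsto_of_tendsto_of_tendsto_of_le_of_le tendsto_const_nhds this
      (fun _ => zero_le) fun n => ?_
    have h : (Y n + Y' n) p - (W + W') p = (Y n p - W p) + (Y' n p - W' p) := by
      simp only [Pi.add_apply]; abel
    simp only [h]
    exact kVectorENorm_add_le _ _ _
  | smul c W _ h =>
    obtain ⟨Y, hY, h⟩ := h
    refine ⟨fun n => c • Y n, fun n => Submodule.smul_mem _ c (hY n), ?_⟩
    filter_upwards [h] with p hp
    have := ENNReal.Tendsto.const_mul (a := ‖c‖ₑ) hp (Or.inr enorm_ne_top)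
    rw [mul_zero] at this
    refine tendsto_of_tendsto_of_tendsto_of_le_of_le tendsto_const_nhds this
      (fun _ => zero_le) fun n => ?_
    have h : (c • Y n) p - (c • W) p = c • (Y n p - W p) := (smul_sub c (Y n p) (W p)).symm
    rw [h]
    exact kVectorENorm_smul_le _ _ _

/-- The set where a measurable field does not vanish is measurable up to a null set. -/
theorem IsMeasurableField.exists_measurableSet [BorelSpace M] (hΩ : IsBoundedAtlas Ω)
    {W : KVectorField E M k} (hW : IsMeasurableField Ω μ W) :
    ∃ B : Set M, MeasurableSet B ∧ ∀ᵐ p ∂μ, p ∈ B ↔ W p ≠ 0 := by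
  obtain ⟨Y, hY, h⟩ := hW
  have hm : ∀ n, Measurable fun p => kVectorENorm Ω p (Y n p) := fun n =>
    (lowerSemicontinuous_kVectorENorm (hY n)).measurable
  -- Almost everywhere `W p = 0` exactly when the norms of `Y n p` tend to zero, a Borel condition
  -- by lower semicontinuity.
  refine ⟨{p | limsup (fun n => kVectorENorm Ω p (Y n p)) atTop = 0}ᶜ,
    (measurableSet_eq_fun (Measurable.limsup hm) measurable_const).compl, ?_⟩
  filter_upwards [h] with p hp
  rw [mem_compl_iff, not_iff_not]
  constructor
  · intro h0
    have hY0 : Tendsto (fun n => kVectorENorm Ω p (Y n p)) atTop (𝓝 0) :=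
      tendsto_of_le_liminf_of_limsup_le zero_le (le_of_eq h0)
    refine hΩ.eq_zero_of_kVectorENorm_eq_zero (nonpos_iff_eq_zero.1 ?_)
    have := hp.add hY0
    rw [add_zero] at this
    refine ge_of_tendsto' this fun n => ?_
    rw [← kVectorENorm_neg p (Y n p - W p)]
    refine le_trans (le_of_eq ?_) (kVectorENorm_add_le p _ _)
    congr 1
    abel
  · intro h0
    rw [h0] at hp
    simp only [sub_zero] at hp
    exact hp.limsup_eq

/-- A field which is orthogonal to all forms of class `C_0¹` is locally orthogonal to the forms with
constant coefficients in a chart. -/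
theorem ae_chartBidual_eq_zero [CompleteSpace E] [T2Space M] [BorelSpace M] [μ.InnerRegular]
    (hΩ : IsBoundedAtlas Ω) (hE : HasC01Bump E) {W : KVectorField E M k}
    (hW : ∀ ω : DiffForm E M k, ω.IsC01 Ω → Integrable (fun p => pairing (ω p) (W p)) μ ∧
      ∫ p, pairing (ω p) (W p) ∂μ = 0)
    {φ : OpenPartialHomeomorph M E} (hφ : φ ∈ Ω) {x : E} {r R : ℝ} (hrR : r < R)
    (hR : Metric.ball x R ⊆ φ.target) {w : E → ℝ} (hw : IsBoundedC1 w)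
    (hsupp : ∀ y, w y ≠ 0 → y ∈ Metric.closedBall x r) (α : E [⋀^Fin k]→L[ℝ] ℝ) :
    ∀ᵐ p ∂μ, p ∈ φ.source → w (φ p) ≠ 0 → pairing (T := E) α
      (exteriorPower.map (N := E) k (mfderiv 𝓘(ℝ, E) 𝓘(ℝ, E) φ p).toLinearMap (W p)) = 0 := by
  -- Multiplying this function by `v ∘ φ` amounts to testing `W` against `φ^*(v w α)`, whose support
  -- stays in that of `w`.
  have key := ae_eq_zero_of_forall_integral_boundedC1_mul_eq_zero (μ := μ) hE φ
    (h := fun p => pairing (pullbackForm φ w α p) (W p))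
    (fun p hp => pairing_pullbackForm_of_notMem φ w α hp _) fun v hv => by
      have h := hW _ (hΩ.isC01_pullbackForm hφ hrR hR (hv.mul hw)
        (fun y hy => hsupp y (right_ne_zero_of_mul hy)) α)
      have heq : ∀ p, pairing (pullbackForm φ (fun y => v y * w y) α p) (W p) =
          v (φ p) * pairing (pullbackForm φ w α p) (W p) := by
        intro p
        by_cases hp : p ∈ φ.source
        · rw [pairing_pullbackForm_of_mem φ _ α hp, pairing_pullbackForm_of_mem φ _ α hp, mul_assoc]
        · rw [pairing_pullbackForm_of_notMem φ _ α hp, pairing_pullbackForm_of_notMem φ _ α hp,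
            mul_zero]
      simpa only [heq] using h
  filter_upwards [key] with p hp hps hwp
  rw [pairing_pullbackForm_of_mem φ w α hps] at hp
  exact (mul_eq_zero.1 hp).resolve_left hwp

/-- A measurable field which is orthogonal to all forms of class `C_0¹` vanishes almost
everywhere. -/
theorem IsMeasurableField.ae_eq_zero [CompleteSpace E] [T2Space M] [BorelSpace M] [μ.InnerRegular]
    (hΩ : IsBoundedAtlas Ω) (hE : HasC01Bump E) {W : KVectorField E M k}
    (hWm : IsMeasurableField Ω μ W)
    (hW : ∀ ω : DiffForm E M k, ω.IsC01 Ω → Integrable (fun p => pairing (ω p) (W p)) μ ∧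
      ∫ p, pairing (ω p) (W p) ∂μ = 0) : ∀ᵐ p ∂μ, W p = 0 := by
  obtain ⟨B, hB, hBW⟩ := hWm.exists_measurableSet hΩ
  suffices hB0 : μ B = 0 by
    filter_upwards [hBW, measure_eq_zero_iff_ae_notMem.1 hB0] with p hp hpB
    by_contra h
    exact hpB (hp.2 h)
  by_contra hne
  obtain ⟨L, hLB, hL, hpos⟩ := hB.exists_lt_isCompact (pos_iff_ne_zero.2 hne)
  -- A compact set is null once each of its points has a neighbourhood meeting it in a null set.
  refine hpos.ne' (hL.measure_zero_of_nhdsWithin fun p₀ _ => ?_)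
  obtain ⟨φ, hφ, hp₀⟩ := hΩ.covers p₀
  obtain ⟨R, hR0, hR⟩ := Metric.nhds_basis_ball.mem_iff.1
    (φ.open_target.mem_nhds (φ.map_source hp₀))
  obtain ⟨w, hw, hw01, hwpos, hws⟩ := hE.exists_bump (φ p₀) (half_pos hR0)
  have hsupp : ∀ y, w y ≠ 0 → y ∈ Metric.closedBall (φ p₀) (R / 2) := fun y hy =>
    Metric.ball_subset_closedBall (hws y hy)
  have hclosed := hΩ.isClosed_preimage_closedBall hφ (half_lt_self hR0) hR
  obtain ⟨Y, hY, hYW⟩ := hWm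
  obtain ⟨A, hA, hAW⟩ := exists_countable_forms hΩ hY hφ (hL.inter_right hclosed)
    fun p hp => hp.2.1
  refine ⟨L ∩ (φ.source ∩ φ ⁻¹' {y | 0 < w y}), inter_mem self_mem_nhdsWithin
    (mem_nhdsWithin_of_mem_nhds ((φ.isOpen_inter_preimage
      (isOpen_lt continuous_const hw.1.continuous)).mem_nhds ⟨hp₀, hwpos⟩)), ?_⟩
  rw [measure_eq_zero_iff_ae_notMem]
  -- Countability of `A` allows the null sets belonging to the individual forms to be merged into
  -- one.
  filter_upwards [hBW, hYW, (ae_ball_iff hA).2 fun α _ =>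
    ae_chartBidual_eq_zero hΩ hE hW hφ (half_lt_self hR0) hR hw hsupp α] with p hpB hpY hpA hp
  have hwp : w (φ p) ≠ 0 := ne_of_gt hp.2.2
  exact hpB.1 (hLB hp.1) (hAW p ⟨hp.1, hp.2.1, hsupp _ hwp⟩ (W p) hpY
    fun α hα => hpA α hα hp.2.1 hwp)

end Fields

end BanachDivergence

end

/-! ### Uniqueness of the divergence -/

open BanachDivergence
theorem mainTheorem2
    {E : Type*} [NormedAddCommGroup E] [NormedSpace ℝ E] [CompleteSpace E]
    {M : Type*} [TopologicalSpace M] [ChartedSpace E M] [IsManifold 𝓘(ℝ, E) 2 M]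
    [T2Space M] [ConnectedSpace M] [MeasurableSpace M] [BorelSpace M]
    (Ω : Set (OpenPartialHomeomorph M E)) (hΩ : IsBoundedAtlas Ω)
    (hE : HasC01Bump E)
    (μ : Measure M) [IsLocallyFiniteMeasure μ] [μ.InnerRegular]
    (k : ℕ) (Z : KVectorField E M (k + 1)) (hZ : Z ∈ Cb1KVectorFields Ω (k + 1))
    (W₁ W₂ : KVectorField E M k)
    (hW₁ : W₁ ∈ L1KVectorFields Ω μ k) (hW₂ : W₂ ∈ L1KVectorFields Ω μ k)
    (hdiv₁ : IsDivergence Ω μ Z W₁) (hdiv₂ : IsDivergence Ω μ Z W₂) :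
    ∀ᵐ p ∂μ, W₁ p = W₂ p := by
  have h : ∀ᵐ p ∂μ, (W₁ - W₂) p = 0 :=
    (isMeasurableField_of_mem_L1KVectorFields (sub_mem hW₁ hW₂)).ae_eq_zero hΩ hE fun ω hω => by
      simp only [Pi.sub_apply, pairing_sub_right]
      refine ⟨(hdiv₁ ω hω).1.sub (hdiv₂ ω hω).1, ?_⟩
      rw [integral_sub (hdiv₁ ω hω).1 (hdiv₂ ω hω).1, (hdiv₁ ω hω).2.2, (hdiv₂ ω hω).2.2, sub_self]
  filter_upwards [h] with p hp
  exact sub_eq_zero.1 hp
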